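/- Let $\widehat{\mathbb Z}=\varprojlim_{n\ge 1}\mathbb Z/n$ be the ring of profinite integers, and let $\widehat{\Lambda}=\varprojlim_I \Lambda/I$ be the profinite completion of the ring $\Lambda=\mathbb Z[t,t^{-1}]$, where $I$ runs over all ideals of $\Lambda$ of finite index. For $\nu\in\widehat{\mathbb Z}$, let $t^\nu\in\widehat{\Lambda}$ be the element whose image in each finite quotient $\Lambda/I$ is $\bar t^{\,k}$, where $\bar t$ is the image of $t$ and $k$ is any integer congruent to $\nu$ modulo the order of $\bar t$ in the finite group $(\Lambda/I)^\times$. Let $f(t)\in\mathbb Z[t]$ be a monic polynomial which is reciprocal, that is, $f(t)=t^{\deg f}f(t^{-1})$. Suppose that for some $\mu\in\widehat{\mathbb Z}^\times$ the principal ideals $(f(t))$ and $(f(t^\mu))$ of $\widehat{\Lambda}$ are equal. Then $f$ is a (possibly empty) product of cyclotomic polynomials $\Phi_n$, $n\ge1$ (repetitions allowed), or $\mu^2=1$ in $\widehat{\mathbb Z}^\times$ (or both). -/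

import Mathlib

noncomputable section

/-- The ring of profinite integers: the inverse limit of the rings `ℤ/n`, `n ≥ 1`. -/
def zhatSubring : Subring (∀ n : ℕ+, ZMod n) where
  carrier := {x | ∀ (m n : ℕ+) (h : (m : ℕ) ∣ n), ZMod.castHom h (ZMod m) (x n) = x m}
  mul_mem' := by
    intro a b ha hb m n h
    simp only [Pi.mul_apply, map_mul, ha m n h, hb m n h]
  one_mem' := by
    intro m n h
    simp only [Pi.one_apply, map_one]
  add_mem' := by
    intro a b ha hb m n h
    simp only [Pi.add_apply, map_add, ha m n h, hb m n h]
  zero_mem' := by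
    intro m n h
    simp only [Pi.zero_apply, map_zero]
  neg_mem' := by
    intro a ha m n h
    simp only [Pi.neg_apply, map_neg, ha m n h]

/-- The ring of profinite integers. -/
abbrev ZHat : Type := zhatSubring

/-- The power `g ^ ν` of an element `g` of a finite group by a profinite integer `ν`: the residue
of `ν` modulo the order of `g` is used as exponent. -/
def zhatPow {G : Type*} [Group G] [Finite G] (g : G) (ν : ZHat) : G :=
  g ^ (ν.1 ⟨orderOf g, orderOf_pos g⟩).val

/-- The components of a profinite integer are compatible, in terms of representatives. -/
theorem zhat_val_cast (ν : ZHat) (m n : ℕ+) (h : (m : ℕ) ∣ n) :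
    ((ν.1 n).val : ZMod m) = ν.1 m := by
  rw [ZMod.natCast_val]
  exact ν.2 m n h

/-- Profinite powers in finite groups are preserved by homomorphisms. -/
theorem map_zhatPow {G H : Type*} [Group G] [Finite G] [Group H] [Finite H] (φ : G →* H)
    (g : G) (ν : ZHat) : φ (zhatPow g ν) = zhatPow (φ g) ν := by
  unfold zhatPow
  rw [map_pow, pow_eq_pow_iff_modEq, ← ZMod.natCast_eq_natCast_iff]
  exact (zhat_val_cast ν ⟨orderOf (φ g), orderOf_pos (φ g)⟩ ⟨orderOf g, orderOf_pos g⟩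
    (orderOf_map_dvd φ g)).trans
    (zhat_val_cast ν ⟨orderOf (φ g), orderOf_pos (φ g)⟩ _ dvd_rfl).symm

namespace ProfiniteRing

/-- The ideals of finite index of a commutative ring. -/
abbrev FiniteIndexIdeal (R : Type*) [CommRing R] : Type _ := {I : Ideal R // Finite (R ⧸ I)}

/-- The profinite completion of a commutative ring `R`: the inverse limit of the finite
quotient rings `R ⧸ I`, as a subring of their product. -/
def completionSubring (R : Type*) [CommRing R] :
    Subring (∀ I : FiniteIndexIdeal R, R ⧸ I.1) where
  carrier := {x | ∀ (I J : FiniteIndexIdeal R) (h : I.1 ≤ J.1),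
    Ideal.Quotient.factor h (x I) = x J}
  mul_mem' := by
    intro a b ha hb I J h
    simp only [Pi.mul_apply, map_mul, ha I J h, hb I J h]
  one_mem' := by
    intro I J h
    simp only [Pi.one_apply, map_one]
  add_mem' := by
    intro a b ha hb I J h
    simp only [Pi.add_apply, map_add, ha I J h, hb I J h]
  zero_mem' := by
    intro I J h
    simp only [Pi.zero_apply, map_zero]
  neg_mem' := by
    intro a ha I J h
    simp only [Pi.neg_apply, map_neg, ha I J h]

/-- The profinite completion of a commutative ring. -/
abbrev Completion (R : Type*) [CommRing R] : Type _ := completionSubring R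

/-- The canonical ring homomorphism from a commutative ring to its profinite completion. -/
def toCompletion (R : Type*) [CommRing R] : R →+* Completion R :=
  RingHom.codRestrict (RingHom.pi fun I : FiniteIndexIdeal R => Ideal.Quotient.mk I.1)
    (completionSubring R) (fun _ _ _ _ => rfl)

/-- The profinite power `u ^ ν` of a unit `u` of `R`, in the profinite completion of `R`:
its image in a finite quotient `R ⧸ I` is the `ν`-th power, in the finite group `(R ⧸ I)ˣ`,
of the image of `u`. -/
def unitPow {R : Type*} [CommRing R] (u : Rˣ) (ν : ZHat) : Completion R :=
  ⟨fun I =>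
      haveI : Finite (R ⧸ I.1) := I.2
      ((zhatPow (Units.map (Ideal.Quotient.mk I.1 : R →* R ⧸ I.1) u) ν : (R ⧸ I.1)ˣ) : R ⧸ I.1),
    by
      intro I J h
      have : Finite (R ⧸ I.1) := I.2
      have : Finite (R ⧸ J.1) := J.2
      exact congrArg Units.val (map_zhatPow
        (Units.map (Ideal.Quotient.factor h : R ⧸ I.1 →* R ⧸ J.1))
        (Units.map (Ideal.Quotient.mk I.1 : R →* R ⧸ I.1) u) ν)⟩

/-- The indeterminate `t` as a unit of `ℤ[t, t⁻¹]`. -/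
def tUnit : (LaurentPolynomial ℤ)ˣ where
  val := LaurentPolynomial.T 1
  inv := LaurentPolynomial.T (-1)
  val_inv := by rw [← LaurentPolynomial.T_add]; simp
  inv_val := by rw [← LaurentPolynomial.T_add]; simp

/-- The element `t` of the profinite completion of `ℤ[t, t⁻¹]`. -/
def tHat : Completion (LaurentPolynomial ℤ) :=
  toCompletion (LaurentPolynomial ℤ) (LaurentPolynomial.T 1)

/-- The element `t ^ ν` of the profinite completion of `ℤ[t, t⁻¹]`, for a profinite
integer `ν`. -/
def tHatPow (ν : ZHat) : Completion (LaurentPolynomial ℤ) := unitPow tUnit ν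

end ProfiniteRing

/-- A polynomial is reciprocal if its coefficient sequence is palindromic, that is,
`f(t) = t ^ (deg f) * f(1/t)`. -/
def IsReciprocalPoly (f : Polynomial ℤ) : Prop := f.reverse = f

/-- A polynomial is a (possibly empty) product of cyclotomic polynomials `Φ_n`, `n ≥ 1`,
repetitions allowed. -/
def IsProductOfCyclotomics (f : Polynomial ℤ) : Prop :=
  ∃ s : Multiset ℕ+, f = (s.map fun n => Polynomial.cyclotomic (n : ℕ) ℤ).prod

end

/-!
Let `p` be a prime and let `ω ∈ ℤ_[p]` be the component of `μ` at `p`. If `α ∈ ℂ_[p]` is a root of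
`f`, all Laurent polynomials take integral values at `α`, since `f` is monic and reciprocal. The
Laurent polynomials that are small at `α` form an ideal of finite index, so the divisibility of
`f(t ^ μ)` by `f(t)` in the profinite completion says that `f(α ^ m)` is small whenever the integer
`m` is close to `μ` (`exists_norm_aeval_pow_le`). For a suitable `M ≥ 1` the powers of `α ^ M`
extend to a continuous character `κ z = (α ^ M) ^ z` of `ℤ_[p]`, and passing to the limit `m → μ`
gives `κ ω = β ^ M` for a root `β` of `f` (`exists_root_addChar_eq_pow`).

Thus raising to the power `μ` induces a self-map of the finite set of roots. If `α` is not a root of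
unity, two iterates agreeing at `α` force two powers of `ω` to agree
(`exists_addChar_and_pow_eq_pow`), so `ω` is a root of unity, in particular algebraic. Now `α ^ M`
and `(α ^ M) ^ ω = β ^ M` are both algebraic, and a `p`-adic Gelfond–Schneider theorem
(`exists_pow_eq_one_of_addChar_algebraic`) shows that `ω` is rational, hence `ω = 1` or `ω = -1`.

If `f` is not a product of cyclotomic polynomials, it has a root that is not a root of unity
(`isProductOfCyclotomics_of_roots`), for every `p`; so every `p`-adic component of `μ ^ 2` is `1`.

The Gelfond–Schneider theorem is proved by Schneider's method, which needs no derivatives. Its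
ingredients are a Schwarz lemma for power series on `ℤ_[p]`
(`HasGeomExpansion.norm_le_of_zeros`), the expansion of `κ` in such a series
(`AddChar.hasGeomExpansion`), Siegel's lemma over number fields (`exists_const_siegel`), Liouville's
inequality (`one_le_norm_mul_house_pow`), and the independence of the functions
`n ↦ n ^ i * a ^ (k * n)` (`eq_zero_of_sum_pow_mul_pow_eq_zero`).
-/

/-! ### Power series with geometrically decreasing coefficients on `ℤ_[p]` -/

section PowerSeries

variable {p : ℕ} [Fact p.Prime] {K : Type*} [NormedField K] [Algebra ℤ_[p] K]

/-- `HasGeomExpansion ρ B F` says that `F : ℤ_[p] → K` is the sum of a power series whose `n`-th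
coefficient has norm at most `B * ρ ^ n`. For `ρ < 1` such a function extends to a disc of radius
greater than `1`, which is what makes zeros in `ℤ_[p]` force small values. -/
def HasGeomExpansion (ρ B : ℝ) (F : ℤ_[p] → K) : Prop :=
  ∃ b : ℕ → K, (∀ n, ‖b n‖ ≤ B * ρ ^ n) ∧
    ∀ z : ℤ_[p], HasSum (fun n => b n * (algebraMap ℤ_[p] K z) ^ n) (F z)

namespace HasGeomExpansion

variable {ρ B : ℝ} {F G : ℤ_[p] → K}

theorem const_mul (hF : HasGeomExpansion ρ B F) {c : K} (hc : ‖c‖ ≤ 1) :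
    HasGeomExpansion ρ B fun z => c * F z := by
  obtain ⟨b, hb, hs⟩ := hF
  refine ⟨fun n => c * b n, fun n => ?_, fun z => ?_⟩
  · rw [norm_mul]
    exact (mul_le_of_le_one_left (norm_nonneg _) hc).trans (hb n)
  · simpa only [mul_assoc] using (hs z).mul_left c

theorem zero (hρ : 0 ≤ ρ) (hB : 0 ≤ B) : HasGeomExpansion ρ B (fun _ : ℤ_[p] => (0 : K)) :=
  ⟨fun _ => 0, fun n => by rw [norm_zero]; positivity, fun z => by simp⟩

theorem const {c : K} (hc : ‖c‖ ≤ 1) (hρ : 0 ≤ ρ) :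
    HasGeomExpansion ρ 1 fun _ : ℤ_[p] => c := by
  refine ⟨fun n => if n = 0 then c else 0, fun n => ?_, fun z => ?_⟩
  · dsimp only
    split_ifs with h
    · simpa [h] using hc
    · rw [norm_zero]; positivity
  · convert hasSum_single (f := fun n => (if n = 0 then c else 0) * (algebraMap ℤ_[p] K z) ^ n) 0
      fun n hn => by simp [hn]
    simp

theorem mul_pow (hF : HasGeomExpansion ρ B F) (hρ : 0 < ρ) (i : ℕ) :
    HasGeomExpansion ρ (B / ρ ^ i) fun z => (algebraMap ℤ_[p] K z) ^ i * F z := by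
  obtain ⟨b, hb, hs⟩ := hF
  have hB : 0 ≤ B := by simpa using (norm_nonneg _).trans (hb 0)
  refine ⟨fun n => if i ≤ n then b (n - i) else 0, fun n => ?_, fun z => ?_⟩
  · dsimp only
    split_ifs with h
    · refine (hb _).trans_eq ?_
      rw [div_mul_eq_mul_div, eq_div_iff (by positivity), mul_assoc, ← pow_add,
        Nat.sub_add_cancel h]
    · rw [norm_zero]; positivity
  · rw [← hasSum_nat_add_iff' i, Finset.sum_eq_zero, sub_zero]
    · refine ((hs z).mul_left ((algebraMap ℤ_[p] K z) ^ i)).congr_fun fun n => ?_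
      dsimp only
      rw [if_pos (Nat.le_add_left _ _), Nat.add_sub_cancel, pow_add]
      ring
    · intro n hn
      dsimp only
      rw [if_neg (by simpa using hn), zero_mul]

theorem mono (hF : HasGeomExpansion ρ B F) (hρ : 0 ≤ ρ) {B' : ℝ} (h : B ≤ B') :
    HasGeomExpansion ρ B' F := by
  obtain ⟨b, hb, hs⟩ := hF
  exact ⟨b, fun n => (hb n).trans (by gcongr), hs⟩

variable [IsUltrametricDist K]

theorem add (hF : HasGeomExpansion ρ B F) (hG : HasGeomExpansion ρ B G) :
    HasGeomExpansion ρ B fun z => F z + G z := by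
  obtain ⟨b, hb, hs⟩ := hF
  obtain ⟨c, hc, ht⟩ := hG
  refine ⟨fun n => b n + c n, fun n => ?_, fun z => ?_⟩
  · exact (IsUltrametricDist.norm_add_le_max _ _).trans (max_le (hb n) (hc n))
  · simpa only [add_mul] using (hs z).add (ht z)

theorem sum {ι : Type*} (s : Finset ι) {F : ι → ℤ_[p] → K} (hρ : 0 ≤ ρ) (hB : 0 ≤ B)
    (hF : ∀ i ∈ s, HasGeomExpansion ρ B (F i)) :
    HasGeomExpansion ρ B fun z => ∑ i ∈ s, F i z := by
  classical
  induction s using Finset.induction_on with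
  | empty => simpa using zero hρ hB
  | insert a s ha ih =>
    simp only [Finset.sum_insert ha]
    exact (hF a (Finset.mem_insert_self _ _)).add
      (ih fun i hi => hF i (Finset.mem_insert_of_mem hi))

end HasGeomExpansion

variable [NormSMulClass ℤ_[p] K]

theorem norm_algebraMap_padicInt (z : ℤ_[p]) : ‖algebraMap ℤ_[p] K z‖ = ‖z‖ := by
  rw [Algebra.algebraMap_eq_smul_one, norm_smul, norm_one, mul_one]

theorem norm_algebraMap_padicInt_le_one (z : ℤ_[p]) : ‖algebraMap ℤ_[p] K z‖ ≤ 1 := by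
  rw [norm_algebraMap_padicInt]; exact z.norm_le_one

theorem charZero_of_normSMulClass_padicInt (p : ℕ) [Fact p.Prime] (K : Type*) [NormedField K]
    [Algebra ℤ_[p] K] [NormSMulClass ℤ_[p] K] : CharZero K :=
  charZero_of_injective_algebraMap (R := ℤ_[p]) fun x y h => by
    rw [← sub_eq_zero, ← norm_eq_zero, ← norm_algebraMap_padicInt (K := K), map_sub, h, sub_self,
      norm_zero]

theorem norm_mul_algebraMap_pow_le (b : K) (z : ℤ_[p]) (n : ℕ) :
    ‖b * (algebraMap ℤ_[p] K z) ^ n‖ ≤ ‖b‖ := by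
  rw [norm_mul, norm_pow]
  exact mul_le_of_le_one_right (norm_nonneg _)
    (pow_le_one₀ (norm_nonneg _) (norm_algebraMap_padicInt_le_one z))

namespace HasGeomExpansion

variable {ρ B : ℝ} {F : ℤ_[p] → K}

/-- Since natural numbers have norm at most one, `z ↦ F (k * z)` inherits the expansion of `F`. -/
theorem comp_natCast_mul (hF : HasGeomExpansion ρ B F) (k : ℕ) :
    HasGeomExpansion ρ B fun z => F ((k : ℤ_[p]) * z) := by
  obtain ⟨b, hb, hs⟩ := hF
  refine ⟨fun n => b n * (k : K) ^ n, fun n => ?_, fun z => ?_⟩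
  · refine le_trans ?_ (hb n)
    simpa using norm_mul_algebraMap_pow_le (p := p) (b n) (k : ℤ_[p]) n
  · simpa only [map_mul, map_natCast, _root_.mul_pow, mul_assoc] using hs ((k : ℤ_[p]) * z)

variable [IsUltrametricDist K]

theorem norm_le (hF : HasGeomExpansion ρ B F) (hρ : 0 ≤ ρ) (hρ1 : ρ ≤ 1) (z : ℤ_[p]) :
    ‖F z‖ ≤ B := by
  obtain ⟨b, hb, hs⟩ := hF
  have hB : 0 ≤ B := by simpa using (norm_nonneg _).trans (hb 0)
  rw [← (hs z).tsum_eq]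
  refine IsUltrametricDist.norm_tsum_le_of_forall_le_of_nonneg hB fun n => ?_
  exact (norm_mul_algebraMap_pow_le _ _ _).trans
    ((hb n).trans (mul_le_of_le_one_right hB (pow_le_one₀ hρ hρ1)))

variable [CompleteSpace K]

/-- A zero `y` can be divided out, at the gain of a factor `ρ` in the bound: the coefficients of
the quotient are `∑ m, b (n + 1 + m) * y ^ m`. -/
theorem exists_eq_sub_mul (hF : HasGeomExpansion ρ B F) (hρ : 0 ≤ ρ) (hρ1 : ρ < 1) {y : ℤ_[p]}
    (hy : F y = 0) : ∃ G : ℤ_[p] → K, HasGeomExpansion ρ (B * ρ) G ∧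
      ∀ z, F z = (algebraMap ℤ_[p] K z - algebraMap ℤ_[p] K y) * G z := by
  obtain ⟨b, hb, hs⟩ := hF
  have hB : 0 ≤ B := by simpa using (norm_nonneg _).trans (hb 0)
  set Y := algebraMap ℤ_[p] K y with hY
  have hsum : ∀ n, Summable fun m => b (n + m) * Y ^ m := fun n => by
    refine Summable.of_norm_bounded (g := fun m => B * ρ ^ n * ρ ^ m)
      ((summable_geometric_of_lt_one hρ hρ1).mul_left _) fun m => ?_
    exact (norm_mul_algebraMap_pow_le _ _ _).trans ((hb _).trans_eq (by rw [pow_add, mul_assoc]))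
  -- `h 0 = F y`, and `h (n + 1)` is the `n`-th coefficient of the quotient.
  set h : ℕ → K := fun n => ∑' m, b (n + m) * Y ^ m with hh
  have hrec : ∀ n, h n = b n + Y * h (n + 1) := fun n => by
    rw [hh]
    simp only
    rw [(hsum n).tsum_eq_zero_add, ← tsum_mul_left]
    simp only [add_zero, pow_zero, mul_one]
    congr 1
    refine tsum_congr fun m => ?_
    rw [show n + (m + 1) = n + 1 + m by ring]
    ring
  have h0 : h 0 = 0 := by
    rw [← hy, ← (hs y).tsum_eq, hh]
    simp [hY]
  have hbound : ∀ n, ‖h n‖ ≤ B * ρ ^ n := fun n => by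
    refine IsUltrametricDist.norm_tsum_le_of_forall_le_of_nonneg (by positivity) fun m => ?_
    refine (norm_mul_algebraMap_pow_le _ _ _).trans ((hb _).trans ?_)
    rw [pow_add]
    have := pow_le_one₀ (n := m) hρ hρ1.le
    have h2 : 0 ≤ B * ρ ^ n := by positivity
    nlinarith
  have hGs : ∀ z : ℤ_[p], Summable fun n => h (n + 1) * (algebraMap ℤ_[p] K z) ^ n := fun z => by
    refine Summable.of_norm_bounded (g := fun n => B * ρ * ρ ^ n)
      ((summable_geometric_of_lt_one hρ hρ1).mul_left _) fun n => ?_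
    exact (norm_mul_algebraMap_pow_le _ _ _).trans
      ((hbound _).trans_eq (by rw [pow_succ]; ring))
  refine ⟨fun z => ∑' n, h (n + 1) * (algebraMap ℤ_[p] K z) ^ n,
    ⟨fun n => h (n + 1), fun n => (hbound _).trans_eq (by rw [pow_succ]; ring),
      fun z => (hGs z).hasSum⟩, fun z => ?_⟩
  set Z := algebraMap ℤ_[p] K z
  have hHs : Summable fun n => h n * Z ^ n := by
    rw [← summable_nat_add_iff 1]
    simpa only [pow_succ, mul_assoc] using (hGs z).mul_right Z
  have e1 : ∑' n, h n * Z ^ n = Z * ∑' n, h (n + 1) * Z ^ n := by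
    rw [hHs.tsum_eq_zero_add, h0, zero_mul, zero_add, ← tsum_mul_left]
    exact tsum_congr fun n => by ring
  have e2 : ∑' n, h n * Z ^ n = F z + Y * ∑' n, h (n + 1) * Z ^ n := by
    rw [← (hs z).tsum_eq, ← tsum_mul_left, ← (hs z).summable.tsum_add ((hGs z).mul_left Y)]
    refine tsum_congr fun n => ?_
    rw [hrec n]
    ring
  rw [sub_mul]
  linear_combination e2.symm.trans e1

/-- A `p`-adic Schwarz lemma: each zero in `ℤ_[p]` improves the bound by a factor `ρ`. -/
theorem norm_le_of_zeros (hρ : 0 ≤ ρ) (hρ1 : ρ < 1) (s : Finset ℤ_[p]) :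
    ∀ {B : ℝ} {F : ℤ_[p] → K}, HasGeomExpansion ρ B F → (∀ y ∈ s, F y = 0) → ∀ z : ℤ_[p],
      ‖F z‖ ≤ B * ρ ^ s.card := by
  classical
  induction s using Finset.induction_on with
  | empty => intro B F hF _ z; simpa using hF.norm_le hρ hρ1.le z
  | insert a s ha ih =>
    intro B F hF hz z
    obtain ⟨G, hG, hFG⟩ := hF.exists_eq_sub_mul hρ hρ1 (hz a (Finset.mem_insert_self _ _))
    have hGz : ∀ y ∈ s, G y = 0 := fun y hy => by
      have h := hFG y
      rw [hz y (Finset.mem_insert_of_mem hy), eq_comm, mul_eq_zero, sub_eq_zero] at h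
      refine h.resolve_left fun h => ha ?_
      have : ‖algebraMap ℤ_[p] K (y - a)‖ = 0 := by rw [map_sub, h, sub_self, norm_zero]
      rw [norm_algebraMap_padicInt, norm_eq_zero, sub_eq_zero] at this
      exact this ▸ hy
    rw [hFG, norm_mul, Finset.card_insert_of_notMem ha, pow_succ', ← mul_assoc, ← map_sub]
    exact (mul_le_of_le_one_left (norm_nonneg _) (norm_algebraMap_padicInt_le_one _)).trans
      (ih hG hGz z)

theorem eq_zero_of_infinite_zeros (hF : HasGeomExpansion ρ B F) (hρ : 0 ≤ ρ) (hρ1 : ρ < 1)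
    (hinf : {y | F y = 0}.Infinite) (z : ℤ_[p]) : F z = 0 := by
  have hlim : Filter.Tendsto (fun n : ℕ => B * ρ ^ n) Filter.atTop (nhds 0) := by
    simpa using (tendsto_pow_atTop_nhds_zero_of_lt_one hρ hρ1).const_mul B
  refine norm_le_zero_iff.1 (ge_of_tendsto' hlim fun n => ?_)
  obtain ⟨s, hs, rfl⟩ := hinf.exists_subset_card_eq n
  exact norm_le_of_zeros hρ hρ1 s hF (fun y hy => hs hy) z

end HasGeomExpansion

end PowerSeries

/-! ### Additive characters of `ℤ_[p]` as power series -/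

section AddCharExpansion

variable {p : ℕ} [Fact p.Prime] {K : Type*} [NormedField K] [Algebra ℤ_[p] K]
  [NormSMulClass ℤ_[p] K]

theorem le_norm_factorial (n : ℕ) : ((p : ℝ)⁻¹) ^ n ≤ ‖(n.factorial : K)‖ := by
  have hp : (1 : ℝ) < p := mod_cast (Fact.out : p.Prime).one_lt
  have h1 : ‖(n.factorial : K)‖ = ‖((n.factorial : ℕ) : ℚ_[p])‖ := by
    rw [← map_natCast (algebraMap ℤ_[p] K), norm_algebraMap_padicInt, PadicInt.norm_def,
      PadicInt.coe_natCast]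
  have h2 : padicValNat p n.factorial ≤ n := by
    have := sub_one_mul_padicValNat_factorial (p := p) n
    have hp2 := (Fact.out : p.Prime).two_le
    calc padicValNat p n.factorial ≤ (p - 1) * padicValNat p n.factorial :=
          Nat.le_mul_of_pos_left _ (by omega)
      _ ≤ n := by omega
  rw [h1, Padic.norm_eq_zpow_neg_valuation (mod_cast n.factorial_ne_zero),
    Padic.valuation_natCast, zpow_neg, zpow_natCast, ← inv_pow]
  exact pow_le_pow_of_le_one (by positivity) (inv_le_one_of_one_le₀ hp.le) h2

/-- A continuous additive character `κ` of `ℤ_[p]` with `κ 1` close to `1` is given by a convergent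
power series: `κ z = ∑ n, (κ 1 - 1) ^ n * choose z n`, and the binomial coefficients are expanded in
powers of `z`. -/
theorem AddChar.hasGeomExpansion [IsUltrametricDist K] [CompleteSpace K] {κ : AddChar ℤ_[p] K}
    (hκ : Continuous κ) (h1 : ‖κ 1 - 1‖ ≤ ((p : ℝ)⁻¹) ^ 2) :
    HasGeomExpansion (p : ℝ)⁻¹ 1 κ := by
  have hp : (1 : ℝ) < p := mod_cast (Fact.out : p.Prime).one_lt
  set ρ : ℝ := (p : ℝ)⁻¹ with hρ
  have hρ0 : 0 < ρ := by positivity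
  have hρ1 : ρ < 1 := inv_lt_one_of_one_lt₀ hp
  set r := κ 1 - 1 with hr
  have hr1 : Filter.Tendsto (r ^ ·) Filter.atTop (nhds 0) :=
    tendsto_pow_atTop_nhds_zero_iff_norm_lt_one.2 (h1.trans_lt (pow_lt_one₀ hρ0.le hρ1 two_ne_zero))
  have hκr : κ = PadicInt.addChar_of_value_at_one r hr1 :=
    PadicInt.eq_addChar_of_value_at_one hr1 hκ (by rw [hr]; ring)
  set s : ℕ → ℕ → K := fun n i => ((descPochhammer ℤ n).coeff i : K) * (r ^ n / n.factorial)
    with hs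
  have hs_zero : ∀ n i, n < i → s n i = 0 := fun n i h => by
    rw [hs]
    simp only
    rw [Polynomial.coeff_eq_zero_of_natDegree_lt (by rwa [descPochhammer_natDegree]),
      Int.cast_zero, zero_mul]
  have hint : ∀ a : ℤ, ‖(a : K)‖ ≤ 1 := fun a => by
    rw [← map_intCast (algebraMap ℤ_[p] K)]
    exact norm_algebraMap_padicInt_le_one _
  have hs_norm : ∀ n i, ‖s n i‖ ≤ ρ ^ n := fun n i => by
    rw [hs]
    simp only
    rw [norm_mul, norm_div, norm_pow]
    refine (mul_le_of_le_one_left (by positivity) (hint _)).trans ?_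
    have h2 := le_norm_factorial (p := p) (K := K) n
    rw [div_le_iff₀ (lt_of_lt_of_le (by positivity) h2)]
    calc ‖r‖ ^ n ≤ (ρ ^ 2) ^ n := pow_le_pow_left₀ (norm_nonneg _) h1 n
      _ = ρ ^ n * ρ ^ n := by rw [pow_two, _root_.mul_pow]
      _ ≤ _ := by gcongr
  have hs_norm' : ∀ n i, ‖s n i‖ ≤ ρ ^ i := fun n i => by
    rcases lt_or_ge n i with h | h
    · rw [hs_zero n i h, norm_zero]; positivity
    · exact (hs_norm n i).trans (pow_le_pow_of_le_one hρ0.le hρ1.le h)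
  -- For `i ≤ n` the bound `ρ ^ n` is at most `q ^ n * q ^ i`, which makes the double series summable.
  set q := Real.sqrt ρ with hq
  have hq0 : 0 ≤ q := Real.sqrt_nonneg _
  have hq1 : q < 1 := by rw [hq, Real.sqrt_lt' one_pos]; simpa using hρ1
  have hqq : q * q = ρ := Real.mul_self_sqrt hρ0.le
  have hs_norm2 : ∀ n i, ‖s n i‖ ≤ q ^ n * q ^ i := fun n i => by
    refine abs_le_of_sq_le_sq' ?_ (by positivity) |>.2
    calc ‖s n i‖ ^ 2 = ‖s n i‖ * ‖s n i‖ := sq _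
      _ ≤ ρ ^ n * ρ ^ i := by
        exact mul_le_mul (hs_norm n i) (hs_norm' n i) (norm_nonneg _) (by positivity)
      _ = (q ^ n * q ^ i) ^ 2 := by rw [← hqq, _root_.mul_pow, _root_.mul_pow]; ring
  have hgeom := summable_geometric_of_lt_one hq0 hq1
  have hsum : ∀ z : ℤ_[p], Summable fun x : ℕ × ℕ => s x.2 x.1 * (algebraMap ℤ_[p] K z) ^ x.1 :=
    fun z => Summable.of_norm_bounded
      (hgeom.mul_of_nonneg hgeom (fun n => pow_nonneg hq0 n) fun n => pow_nonneg hq0 n)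
      fun x => (norm_mul_algebraMap_pow_le _ _ _).trans ((hs_norm2 _ _).trans_eq (mul_comm _ _))
  have hcol : ∀ i, Summable fun n => s n i := fun i =>
    Summable.of_norm_bounded (hgeom.mul_right (q ^ i)) fun n => hs_norm2 n i
  refine ⟨fun i => ∑' n, s n i, fun i => ?_, fun z => ?_⟩
  · rw [one_mul]
    exact IsUltrametricDist.norm_tsum_le_of_forall_le_of_nonneg (by positivity)
      fun n => hs_norm' n i
  · set Z := algebraMap ℤ_[p] K z with hZ
    have hrow : ∀ n, HasSum (fun i => s n i * Z ^ i) (mahler n z • r ^ n) := fun n => by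
      have e : mahler n z • r ^ n = ∑ i ∈ Finset.range (n + 1), s n i * Z ^ i := by
        have h := congrArg (algebraMap ℤ_[p] K)
          (Ring.descPochhammer_eq_factorial_smul_choose z n)
        rw [Polynomial.smeval_eq_sum, Polynomial.sum_over_range' _ _ (n + 1) (by
          rw [descPochhammer_natDegree]; omega), map_sum, nsmul_eq_mul, map_mul, map_natCast] at h
        · have hn : (n.factorial : K) ≠ 0 := fun h0 => by
            have h2 := le_norm_factorial (p := p) (K := K) n
            rw [h0, norm_zero] at h2
            exact absurd h2 (not_le.2 (by positivity))
          rw [mahler_apply, Algebra.smul_def, eq_div_of_mul_eq hn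
            ((mul_comm _ _).trans h.symm), Finset.sum_div, Finset.sum_mul]
          refine Finset.sum_congr rfl fun i _ => ?_
          simp only [Polynomial.smul_pow, hs, zsmul_eq_mul, map_mul, map_intCast, map_pow, hZ]
          ring
        · intro i
          simp [Polynomial.smul_pow]
      rw [e]
      refine hasSum_sum_of_ne_finset_zero fun i hi => ?_
      rw [hs_zero n i (by simpa using hi), zero_mul]
    have hκz : κ z = ∑' n, mahler n z • r ^ n := by
      rw [hκr, PadicInt.coe_addChar_of_value_at_one, PadicInt.mahlerSeries_apply hr1]
    have htot : κ z = ∑' x : ℕ × ℕ, s x.2 x.1 * Z ^ x.1 := by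
      rw [hκz, ← (Equiv.prodComm ℕ ℕ).tsum_eq]
      simp only [Equiv.prodComm_apply, Prod.fst_swap, Prod.snd_swap]
      have h : Summable fun x : ℕ × ℕ => s x.1 x.2 * Z ^ x.2 :=
        (hsum z).prod_symm
      exact (h.hasSum.prod_fiberwise hrow).tsum_eq
    rw [htot]
    refine (hsum z).hasSum.prod_fiberwise fun i => ?_
    exact (hcol i).hasSum.mul_right (Z ^ i)

end AddCharExpansion

/-! ### Independence of exponential polynomials -/

section ExponentialPolynomials

open Polynomial

variable {K : Type*} [Field K]

/-- Exponential monomials `n ↦ Q(n) * a ^ n` with distinct bases `a` lie in distinct generalized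
eigenspaces of the shift operator, hence are independent. -/
theorem eq_zero_of_sum_eval_mul_pow_eq_zero [CharZero K] {ι : Type*} [Fintype ι] (Q : ι → K[X])
    {a : ι → K} (ha : Function.Injective a) (ha0 : ∀ k, a k ≠ 0)
    (h : ∀ n : ℕ, ∑ k, (Q k).eval (n : K) * a k ^ n = 0) (k : ι) : Q k = 0 := by
  let S : Module.End K (ℕ → K) := LinearMap.funLeft K K Nat.succ
  have hS : ∀ (u : ℕ → K) n, S u n = u (n + 1) := fun u n => rfl
  have hstep : ∀ (c : K) (P : K → K),
      (S - algebraMap K _ c) (fun n => P n * c ^ n) =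
        c • fun n : ℕ => (fwdDiff 1 P) n * c ^ n := fun c P => by
    ext n
    simp only [LinearMap.sub_apply, Pi.sub_apply, hS, Module.algebraMap_end_apply, Pi.smul_apply,
      smul_eq_mul, fwdDiff, Nat.cast_add, Nat.cast_one]
    ring
  have hiter : ∀ (c : K) (m : ℕ) (P : K → K),
      ((S - algebraMap K _ c) ^ m) (fun n => P n * c ^ n) =
        c ^ m • fun n : ℕ => ((fwdDiff 1)^[m] P) n * c ^ n := fun c m => by
    induction m with
    | zero => intro P; simp
    | succ m ih =>
      intro P
      rw [pow_succ, Module.End.mul_apply, hstep, map_smul, ih, smul_smul, ← pow_succ']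
      rfl
  have hmem : ∀ k, (fun n : ℕ => (Q k).eval (n : K) * a k ^ n) ∈ S.maxGenEigenspace (a k) :=
    fun k => by
    rw [Module.End.mem_maxGenEigenspace]
    refine ⟨(Q k).natDegree + 1, ?_⟩
    have := hiter (a k) ((Q k).natDegree + 1) fun x => (Q k).eval x
    rw [Polynomial.fwdDiff_iter_degree_add_one_eq_zero] at this
    rw [← Algebra.algebraMap_eq_smul_one, this]
    ext n
    simp
  have hind := (S.independent_maxGenEigenspace.comp ha)
  rw [iSupIndep_iff_finsetSum_eq_zero_imp_eq_zero] at hind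
  have hk := hind Finset.univ (fun k n => (Q k).eval (n : K) * a k ^ n) (fun k _ => hmem k)
    (by ext n; simpa using h n) k (Finset.mem_univ k)
  refine Polynomial.eq_zero_of_infinite_isRoot _ ?_
  refine (Set.infinite_range_of_injective (Nat.cast_injective (R := K))).mono ?_
  rintro _ ⟨n, rfl⟩
  have := congrFun hk n
  exact (mul_eq_zero.1 this).resolve_right (pow_ne_zero _ (ha0 k))

end ExponentialPolynomials

/-! ### Heights of algebraic integers -/

section Heights

open NumberField

theorem IsIntegral.norm_le_one_of_isUltrametricDist {K : Type*} [NormedField K]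
    [IsUltrametricDist K] {x : K} (hx : IsIntegral ℤ x) : ‖x‖ ≤ 1 := by
  have h : IsIntegral (NormedField.valuation (K := K)).integer x := hx.tower_top
  have := (Valuation.integer.integers (NormedField.valuation (K := K))).mem_of_integral h
  rw [Valuation.mem_integer_iff, NormedField.valuation_apply] at this
  exact_mod_cast this

/-- The form of Siegel's lemma for twice as many unknowns as equations, with a constant depending
only on the field. -/
theorem exists_const_siegel (L : Type*) [Field L] [NumberField L] : ∃ c : ℝ, 1 ≤ c ∧
    ∀ (E U : Type) [Fintype E] [Fintype U] (M : Matrix E U (𝓞 L)) (A : ℝ),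
      0 < Fintype.card E → Fintype.card U = 2 * Fintype.card E → M ≠ 0 →
      (∀ e u, house (M e u : L) ≤ A) →
      ∃ x : U → 𝓞 L, x ≠ 0 ∧ M.mulVec x = 0 ∧
        ∀ u, house (x u : L) ≤ c * (c * Fintype.card U * A) := by
  classical
  suffices h : ∃ c : ℝ, ∀ (E U : Type) [Fintype E] [Fintype U] (M : Matrix E U (𝓞 L)) (A : ℝ),
      0 < Fintype.card E → Fintype.card U = 2 * Fintype.card E → M ≠ 0 →
      (∀ e u, house (M e u : L) ≤ A) →
      ∃ x : U → 𝓞 L, x ≠ 0 ∧ M.mulVec x = 0 ∧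
        ∀ u, house (x u : L) ≤ c * (c * Fintype.card U * A) by
    obtain ⟨c, hc⟩ := h
    refine ⟨max 1 |c|, le_max_left _ _, fun E U _ _ M A hE hU hM hA => ?_⟩
    obtain ⟨x, hx0, hx1, hx⟩ := hc E U M A hE hU hM hA
    refine ⟨x, hx0, hx1, fun u => (hx u).trans ?_⟩
    have hE' : Nonempty E := Fintype.card_pos_iff.1 hE
    have hA0 : 0 ≤ A := (house_nonneg _).trans (hA hE'.some u)
    have hcc : c * c ≤ max 1 |c| * max 1 |c| := by
      rw [← abs_mul_abs_self c]
      exact mul_self_le_mul_self (abs_nonneg _) (le_max_right _ _)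
    have : 0 ≤ Fintype.card U * A := by positivity
    nlinarith
  -- The constant is that of `house.exists_ne_zero_int_vec_house_le`; for twice as many unknowns as
  -- equations the exponent there is `1`.
  refine ⟨?_, fun E U _ _ M A hE hU hM hA => ?_⟩
  swap
  · obtain ⟨x, hx0, hx1, hx⟩ := house.exists_ne_zero_int_vec_house_le L M hM hE
      (by rw [hU]; omega) rfl hA rfl
    refine ⟨x, hx0, hx1, fun u => (hx u).trans_eq ?_⟩
    rw [show (Fintype.card E : ℝ) / (Fintype.card U - Fintype.card E) = 1 by
      have : (Fintype.card E : ℝ) ≠ 0 := by exact_mod_cast hE.ne'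
      rw [hU]; push_cast; field_simp; ring, Real.rpow_one]

theorem one_le_norm_mul_natCast (p : ℕ) [Fact p.Prime] {K : Type*} [NormedField K]
    [Algebra ℤ_[p] K] [NormSMulClass ℤ_[p] K] {m : ℕ} (hm : m ≠ 0) : 1 ≤ ‖(m : K)‖ * m := by
  have hp : (0 : ℝ) < p := mod_cast (Fact.out : p.Prime).pos
  have h1 : ‖(m : K)‖ = ‖(m : ℚ_[p])‖ := by
    rw [← map_natCast (algebraMap ℤ_[p] K), norm_algebraMap_padicInt, PadicInt.norm_def,
      PadicInt.coe_natCast]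
  rw [h1, Padic.norm_eq_zpow_neg_valuation (mod_cast hm), Padic.valuation_natCast, zpow_neg,
    zpow_natCast, inv_mul_eq_div, one_le_div (by positivity)]
  exact_mod_cast Nat.le_of_dvd (Nat.pos_of_ne_zero hm) pow_padicValNat_dvd

/-- Liouville's inequality: the norm of `x` is a nonzero integer of absolute value at most
`house x ^ d`, and it is divisible by `x`. -/
theorem one_le_norm_mul_house_pow (p : ℕ) [Fact p.Prime] {K : Type*} [NormedField K]
    [Algebra ℤ_[p] K] [NormSMulClass ℤ_[p] K] [IsUltrametricDist K] {L : Type*} [Field L]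
    [NumberField L] (σ : L →+* K) {x : 𝓞 L} (hx : x ≠ 0) :
    1 ≤ ‖σ x‖ * house (x : L) ^ Module.finrank ℚ L := by
  set m := Ideal.absNorm (Ideal.span {x}) with hm
  have hm0 : m ≠ 0 := by rw [hm, Ne, Ideal.absNorm_eq_zero_iff]; simpa using hx
  obtain ⟨y, hy⟩ := Ideal.mem_span_singleton'.1 (Ideal.absNorm_mem (Ideal.span {x}))
  have h1 : ‖(m : K)‖ ≤ ‖σ x‖ := by
    have : (m : K) = σ y * σ x := by
      rw [← map_mul, ← map_natCast σ]
      congr 1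
      rw [← map_mul, hy, map_natCast]
    rw [this, norm_mul]
    refine mul_le_of_le_one_left (norm_nonneg _) ?_
    exact (y.isIntegral_coe.map σ.toIntAlgHom).norm_le_one_of_isUltrametricDist
  have h2 : (m : ℝ) ≤ house (x : L) ^ Module.finrank ℚ L := by
    have σ' : L →+* ℂ := Classical.arbitrary _
    have h := norm_norm_le_norm_mul_house_pow (x : L) σ'
    have h3 : (m : ℝ) = ‖Algebra.norm ℚ (x : L)‖ := by
      rw [hm, Ideal.absNorm_span_singleton, ← Algebra.coe_norm_int, Nat.cast_natAbs,
        Int.norm_cast_rat, Int.norm_eq_abs, Int.cast_abs]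
    rw [h3]
    refine h.trans ?_
    calc _ ≤ house (x : L) * house (x : L) ^ (Module.finrank ℚ L - 1) := by
          have := house_nonneg (x : L)
          gcongr
          exact norm_embedding_le_house _ _
      _ = _ := by rw [← pow_succ', Nat.sub_add_cancel Module.finrank_pos]
  exact (one_le_norm_mul_natCast p (K := K) hm0).trans (by gcongr)

/-- The numerical comparison behind the choice of parameters: with `2 * n ^ 2 ≤ S` the left hand
side is `exp (O (S ^ (7 / 4)))`. -/
theorem exists_schneider_parameter {P H c : ℝ} (hP : 1 < P) (hH : 1 ≤ H) (hc : 1 ≤ c) (d : ℕ) :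
    ∃ n : ℕ, 0 < n ∧ ∀ S : ℕ, 2 * n ^ 2 ≤ S →
      P ^ (8 * n ^ 3) * (8 * n ^ 4 * c * (((S + 1 : ℕ) * H) ^ (8 * n ^ 3) *
        (H ^ (2 * (S + 1))) ^ n)) ^ (2 * d) < P ^ (S ^ 2) := by
  have hlP : 0 < Real.log P := Real.log_pos hP
  set A : ℝ := 8 * Real.log P + 2 * d * (10 + c + 8 * (5 + H) + 4 * H) with hA
  obtain ⟨n, hn⟩ := exists_nat_gt ((A / Real.log P) ^ 2 + 1)
  have hn0 : (0 : ℝ) ≤ (A / Real.log P) ^ 2 := by positivity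
  have hn1 : (1 : ℝ) ≤ n := by linarith
  refine ⟨n, by exact_mod_cast hn1, fun S hS => ?_⟩
  have hS' : 2 * (n : ℝ) ^ 2 ≤ S := by exact_mod_cast hS
  -- All terms are compared with powers of `u = S ^ (1 / 4)`.
  set u : ℝ := Real.sqrt (Real.sqrt S) with hu
  have hu0 : 0 ≤ u := Real.sqrt_nonneg _
  have hu2 : u ^ 2 = Real.sqrt S := Real.sq_sqrt (Real.sqrt_nonneg _)
  have hu4 : u ^ 4 = S := by
    rw [show u ^ 4 = (u ^ 2) ^ 2 by ring, hu2, Real.sq_sqrt (Nat.cast_nonneg _)]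
  have hnu : (n : ℝ) ≤ u ^ 2 := by
    rw [hu2]; exact Real.le_sqrt_of_sq_le (by nlinarith)
  have hAu : A < u * Real.log P := by
    rw [← div_lt_iff₀ hlP]
    refine lt_of_pow_lt_pow_left₀ 2 hu0 ?_
    linarith
  have hu1 : 1 ≤ u := by
    by_contra hlt
    have : u ^ 2 < 1 := pow_lt_one₀ hu0 (not_le.1 hlt) two_ne_zero
    linarith
  have hS1 : (1 : ℝ) ≤ S := by rw [← hu4]; exact one_le_pow₀ hu1
  have hlogu : Real.log u ≤ u := (Real.log_le_sub_one_of_pos (by linarith)).trans (by linarith)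
  have hlogH : Real.log H ≤ H := (Real.log_le_sub_one_of_pos (by linarith)).trans (by linarith)
  have hlogc : Real.log c ≤ c := (Real.log_le_sub_one_of_pos (by linarith)).trans (by linarith)
  have hlogH0 : 0 ≤ Real.log H := Real.log_nonneg hH
  have hlog2 : Real.log 2 ≤ 1 := (Real.log_le_sub_one_of_pos (by norm_num)).trans (by norm_num)
  have b1 : Real.log (8 * n ^ 4) ≤ 10 * u ^ 7 := by
    have : (8 : ℝ) * n ^ 4 ≤ 2 * u ^ 8 := by
      rw [show u ^ 8 = (u ^ 4) ^ 2 by ring, hu4]; nlinarith [sq_nonneg (n : ℝ)]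
    refine (Real.log_le_log (by positivity) this).trans ?_
    rw [Real.log_mul two_ne_zero (by positivity), Real.log_pow]
    have h7 : u ≤ u ^ 7 := le_self_pow₀ hu1 (by norm_num)
    push_cast
    linarith
  have b2 : Real.log c ≤ c * u ^ 7 := by
    have h7 : 1 ≤ u ^ 7 := one_le_pow₀ hu1
    nlinarith
  have hn3 : 8 * (n : ℝ) ^ 3 ≤ 8 * u ^ 6 := by
    rw [show u ^ 6 = (u ^ 2) ^ 3 by ring]
    gcongr
  have b3 : 8 * (n : ℝ) ^ 3 * Real.log ((S + 1 : ℕ) * H) ≤ 8 * (5 + H) * u ^ 7 := by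
    have e : Real.log ((S + 1 : ℕ) * H) ≤ (5 + H) * u := by
      have hS2 : ((S + 1 : ℕ) : ℝ) ≤ 2 * u ^ 4 := by rw [hu4]; push_cast; linarith
      rw [Real.log_mul (by positivity) (by positivity)]
      have := Real.log_le_log (by positivity) hS2
      rw [Real.log_mul two_ne_zero (by positivity), Real.log_pow] at this
      push_cast at this ⊢
      nlinarith
    have h0 : 0 ≤ (5 + H) * u := by positivity
    calc _ ≤ 8 * (n : ℝ) ^ 3 * ((5 + H) * u) := by gcongr
      _ ≤ 8 * u ^ 6 * ((5 + H) * u) := by gcongr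
      _ = _ := by ring
  have b4 : n * (2 * ((S + 1 : ℕ) : ℝ) * Real.log H) ≤ 4 * H * u ^ 7 := by
    have hS2 : ((S + 1 : ℕ) : ℝ) ≤ 2 * u ^ 4 := by rw [hu4]; push_cast; linarith
    calc _ ≤ u ^ 2 * (2 * (2 * u ^ 4) * H) := by gcongr
      _ = 4 * H * u ^ 6 := by ring
      _ ≤ 4 * H * u ^ 7 := by
        exact mul_le_mul_of_nonneg_left (pow_le_pow_right₀ hu1 (by norm_num)) (by positivity)
  rw [← Real.log_lt_log_iff (by positivity) (by positivity)]
  have hX : Real.log (8 * n ^ 4 * c * (((S + 1 : ℕ) * H) ^ (8 * n ^ 3) *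
      (H ^ (2 * (S + 1))) ^ n)) = Real.log (8 * n ^ 4) + Real.log c +
        (8 * (n : ℝ) ^ 3 * Real.log ((S + 1 : ℕ) * H) +
          n * (2 * ((S + 1 : ℕ) : ℝ) * Real.log H)) := by
    have hN : (8 * n ^ 4 : ℝ) ≠ 0 := by positivity
    generalize (8 * n ^ 4 : ℝ) = N at hN
    rw [Real.log_mul (by positivity) (by positivity), Real.log_mul hN (by positivity),
      Real.log_mul (by positivity) (by positivity), Real.log_pow, Real.log_pow, Real.log_pow]
    push_cast
    ring
  rw [Real.log_mul (by positivity) (by positivity), Real.log_pow, Real.log_pow, Real.log_pow, hX]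
  have hsum : Real.log (8 * n ^ 4) + Real.log c +
        (8 * (n : ℝ) ^ 3 * Real.log ((S + 1 : ℕ) * H) +
          n * (2 * ((S + 1 : ℕ) : ℝ) * Real.log H)) ≤
      (10 + c + 8 * (5 + H) + 4 * H) * u ^ 7 := by linarith
  have hD1 : 8 * (n : ℝ) ^ 3 * Real.log P ≤ 8 * Real.log P * u ^ 7 := by
    have : u ^ 6 ≤ u ^ 7 := pow_le_pow_right₀ hu1 (by norm_num)
    nlinarith
  have hd : 2 * (d : ℝ) * (Real.log (8 * n ^ 4) + Real.log c +
        (8 * (n : ℝ) ^ 3 * Real.log ((S + 1 : ℕ) * H) +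
          n * (2 * ((S + 1 : ℕ) : ℝ) * Real.log H))) ≤
      2 * d * ((10 + c + 8 * (5 + H) + 4 * H) * u ^ 7) := by gcongr
  push_cast at hd hsum ⊢
  calc _ ≤ 8 * Real.log P * u ^ 7 + 2 * d * ((10 + c + 8 * (5 + H) + 4 * H) * u ^ 7) := by
        linarith
    _ = A * u ^ 7 := by rw [hA]; ring
    _ < u * Real.log P * u ^ 7 := by gcongr
    _ = (u ^ 4) ^ 2 * Real.log P := by ring
    _ = _ := by rw [hu4]

end Heights

/-! ### A `p`-adic Gelfond–Schneider theorem -/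

section GelfondSchneider

open NumberField

variable {p : ℕ} [Fact p.Prime] {K : Type*} [NormedField K] [Algebra ℤ_[p] K]
  [NormSMulClass ℤ_[p] K] [IsUltrametricDist K] [CompleteSpace K]

theorem house_schneider_entry_le {L : Type*} [Field L] [NumberField L] {a b w : L} {H : ℝ}
    (hH : 1 ≤ H) (ha : house a ≤ H) (hb : house b ≤ H) (hw : 1 + house w ≤ H) {S D E : ℕ}
    (hS : 1 ≤ S) {x y i k : ℕ} (hx : x ≤ S) (hy : y ≤ S) (hi : i ≤ D) (hk : k ≤ E) :
    house (((x : L) + y * w) ^ i * (a ^ x * b ^ y) ^ k) ≤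
      (S * H) ^ D * (H ^ (2 * S)) ^ E := by
  have hx' : (x : ℝ) ≤ S := by exact_mod_cast hx
  have hy' : (y : ℝ) ≤ S := by exact_mod_cast hy
  have hS' : (1 : ℝ) ≤ S := by exact_mod_cast hS
  have h1 : house ((x : L) + y * w) ≤ S * H := by
    refine (house_add_le _ _).trans ?_
    have hx1 : house (x : L) = x := by
      have := house_intCast (K := L) (x : ℤ)
      simpa using this
    rw [house_nat_mul, hx1]
    have := house_nonneg w
    nlinarith
  have h2 : house (a ^ x * b ^ y) ≤ H ^ (2 * S) := by
    calc _ ≤ house a ^ x * house b ^ y :=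
          (house_mul_le _ _).trans (mul_le_mul (house_pow_le _ _) (house_pow_le _ _)
            (house_nonneg _) (pow_nonneg (house_nonneg _) _))
      _ ≤ H ^ x * H ^ y := by
          have := house_nonneg a
          have := house_nonneg b
          gcongr
      _ = H ^ (x + y) := (pow_add _ _ _).symm
      _ ≤ _ := pow_le_pow_right₀ hH (by omega)
  calc _ ≤ house ((x : L) + y * w) ^ i * house (a ^ x * b ^ y) ^ k :=
        (house_mul_le _ _).trans (mul_le_mul (house_pow_le _ _) (house_pow_le _ _)
          (house_nonneg _) (pow_nonneg (house_nonneg _) _))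
    _ ≤ (S * H) ^ i * (H ^ (2 * S)) ^ k :=
        mul_le_mul (pow_le_pow_left₀ (house_nonneg _) h1 _)
          (pow_le_pow_left₀ (house_nonneg _) h2 _) (pow_nonneg (house_nonneg _) _) (by positivity)
    _ ≤ _ := by
        have h3 : 1 ≤ S * H := by nlinarith
        have h4 : 1 ≤ H ^ (2 * S) := one_le_pow₀ hH
        gcongr

/-- A relation among the functions `n ↦ n ^ i * a ^ (k * n)` on the natural numbers is trivial
unless `a` is zero or a root of unity. -/
theorem eq_zero_of_sum_pow_mul_pow_eq_zero {F : Type*} [Field F] [CharZero F] {a : F} (ha0 : a ≠ 0)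
    (ha : ∀ n : ℕ, 0 < n → a ^ n ≠ 1) {D E : ℕ} (c : Fin D × Fin E → F)
    (h : ∀ n : ℕ, ∑ u, c u * ((n : F) ^ (u.1 : ℕ) * (a ^ n) ^ (u.2 : ℕ)) = 0) : c = 0 := by
  have hinj : Function.Injective fun k : Fin E => a ^ (k : ℕ) := by
    have hf : ¬ IsOfFinOrder a := by
      rw [isOfFinOrder_iff_pow_eq_one]
      rintro ⟨n, hn, h⟩
      exact ha n hn h
    intro k l hkl
    have h1 := (injective_pow_iff_not_isOfFinOrder (x := Units.mk0 a ha0)).2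
      (by rwa [← Units.isOfFinOrder_val])
    exact Fin.ext (h1 (Units.ext (by simpa using hkl)))
  have hQ := eq_zero_of_sum_eval_mul_pow_eq_zero
    (fun k : Fin E => ∑ i : Fin D, Polynomial.monomial (i : ℕ) (c (i, k))) hinj
    (fun k => pow_ne_zero _ ha0) fun n => by
      rw [← h n, Fintype.sum_prod_type_right]
      refine Finset.sum_congr rfl fun k _ => ?_
      rw [Polynomial.eval_finsetSum, Finset.sum_mul]
      refine Finset.sum_congr rfl fun i _ => ?_
      rw [Polynomial.eval_monomial, ← pow_mul, ← pow_mul, mul_comm n, mul_assoc]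
  ext ⟨i, k⟩
  have := congrArg (fun q => q.coeff (i : ℕ)) (hQ k)
  simpa [Polynomial.finsetSum_coeff, Polynomial.coeff_monomial, Fin.val_inj] using this

/-- A `p`-adic Gelfond–Schneider theorem: if `κ 1 = a` and `κ ω = a ^ ω` are algebraic for an
irrational algebraic `ω`, then `a` is a root of unity. By Schneider's method, Siegel's lemma yields
an auxiliary function `F z = ∑ C (i, k) * z ^ i * a ^ (k * z)` vanishing at the points `x + y * ω`
with `x, y < S₀`; the Schwarz lemma and Liouville's inequality show by induction that it vanishes
for all natural numbers `x, y`. -/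
theorem exists_pow_eq_one_of_addChar_algebraic {L : Type*} [Field L] [NumberField L] (σ : L →+* K)
    {a b w : 𝓞 L} {ω : ℤ_[p]} {κ : AddChar ℤ_[p] K} (hκ : Continuous κ)
    (h1 : ‖κ 1 - 1‖ ≤ ((p : ℝ)⁻¹) ^ 2) (ha : σ a = κ 1) (hb : σ b = κ ω)
    (hw : σ w = algebraMap ℤ_[p] K ω)
    (hirr : ∀ x y : ℤ, (x : ℤ_[p]) + y * ω = 0 → x = 0 ∧ y = 0) :
    ∃ n : ℕ, 0 < n ∧ κ 1 ^ n = 1 := by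
  classical
  by_contra! hne
  have : CharZero K := (RingHom.charZero_iff σ.injective).1 inferInstance
  have hp : (1 : ℝ) < p := mod_cast (Fact.out : p.Prime).one_lt
  set ρ : ℝ := (p : ℝ)⁻¹ with hρ
  have hρ0 : 0 < ρ := by positivity
  have hρ1 : ρ < 1 := inv_lt_one_of_one_lt₀ hp
  obtain ⟨c, hc1, hsiegel⟩ := exists_const_siegel L
  set H : ℝ := 1 + house (a : L) + house (b : L) + house (w : L) with hH
  have ha0 := house_nonneg (a : L)
  have hb0 := house_nonneg (b : L)
  have hw0 := house_nonneg (w : L)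
  have hH1 : 1 ≤ H := by linarith
  set d := Module.finrank ℚ L with hd
  obtain ⟨n, hn0, hn⟩ := exists_schneider_parameter hp hH1 hc1 d
  -- The degrees are chosen so that the `D * n = 8 * n ^ 4` coefficients of the auxiliary function are
  -- twice as many as the `S₀ ^ 2 = 4 * n ^ 4` conditions.
  set D := 8 * n ^ 3 with hD
  set S₀ := 2 * n ^ 2 with hS₀
  let X : ℕ → ℝ := fun S => (S * H) ^ D * (H ^ (2 * S)) ^ n
  let v : ℕ → ℕ → Fin D × Fin n → 𝓞 L := fun x y u =>
    ((x : 𝓞 L) + y * w) ^ (u.1 : ℕ) * (a ^ x * b ^ y) ^ (u.2 : ℕ)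
  have hv : ∀ S x y u, 1 ≤ S → x ≤ S → y ≤ S → house (v x y u : L) ≤ X S := by
    intro S x y u hS hx hy
    have := house_schneider_entry_le (L := L) (a := a) (b := b) (w := w) hH1 (by linarith)
      (by linarith) (by linarith) hS hx hy u.1.2.le u.2.2.le
    simpa [v, X] using this
  have hS₀pos : 1 ≤ S₀ := Nat.succ_le_of_lt (by positivity)
  have hcardE : Fintype.card (Fin S₀ × Fin S₀) = 4 * n ^ 4 := by
    simp only [Fintype.card_prod, Fintype.card_fin, hS₀]; ring
  have hcardU : Fintype.card (Fin D × Fin n) = 8 * n ^ 4 := by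
    simp only [Fintype.card_prod, Fintype.card_fin, hD]; ring
  have hDpos : 0 < D := by positivity
  obtain ⟨C, hC0, hCM, hC⟩ := hsiegel (Fin S₀ × Fin S₀) (Fin D × Fin n)
    (fun e u => v e.1 e.2 u) (X S₀) (by rw [hcardE]; positivity)
    (by rw [hcardE, hcardU]; ring) (fun h => by
      have := congrFun (congrFun h (⟨0, hS₀pos⟩, ⟨0, hS₀pos⟩)) (⟨0, hDpos⟩, ⟨0, hn0⟩)
      simp [v] at this) (fun e u => hv S₀ _ _ u hS₀pos e.1.2.le e.2.2.le)
  rw [hcardU] at hC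
  let ξ : ℕ → ℕ → 𝓞 L := fun x y => ∑ u, v x y u * C u
  let F : ℤ_[p] → K := fun z => ∑ u : Fin D × Fin n, σ (C u) *
    ((algebraMap ℤ_[p] K z) ^ (u.1 : ℕ) * κ (((u.2 : ℕ) : ℤ_[p]) * z))
  have hκk : ∀ (k : ℕ) z, κ ((k : ℤ_[p]) * z) = κ z ^ k := fun k z => by
    rw [← nsmul_eq_mul, AddChar.map_nsmul_eq_pow]
  have hFξ : ∀ x y : ℕ, F (x + y * ω) = σ (ξ x y) := fun x y => by
    have hκxy : κ (x + y * ω) = κ 1 ^ x * κ ω ^ y := by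
      rw [AddChar.map_add_eq_mul, hκk, ← mul_one (x : ℤ_[p]), hκk]
    simp only [F, ξ, v, hκk, hκxy, map_sum, map_mul, map_pow, map_add, map_natCast, ha, hb, hw]
    exact Finset.sum_congr rfl fun u _ => mul_comm _ _
  have hF : HasGeomExpansion ρ (1 / ρ ^ D) F := by
    refine HasGeomExpansion.sum _ hρ0.le (by positivity) fun u _ => ?_
    refine HasGeomExpansion.const_mul ?_
      ((C u).isIntegral_coe.map σ.toIntAlgHom).norm_le_one_of_isUltrametricDist
    refine (((AddChar.hasGeomExpansion hκ h1).comp_natCast_mul _).mul_pow hρ0 _).mono hρ0.le ?_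
    exact one_div_le_one_div_of_le (by positivity) (pow_le_pow_of_le_one hρ0.le hρ1.le u.1.2.le)
  have hzero : ∀ S, S₀ ≤ S → ∀ x y, x < S → y < S → ξ x y = 0 := by
    intro S hS
    induction S, hS using Nat.le_induction with
    | base =>
      intro x y hx hy
      exact congrFun hCM (⟨x, hx⟩, ⟨y, hy⟩)
    | succ S hS ih =>
      intro x y hx hy
      by_contra hxy
      -- The `S ^ 2` zeros already found make the value at the new point too small to be nonzero.
      let s : Finset ℤ_[p] := (Finset.range S ×ˢ Finset.range S).image
        fun e : ℕ × ℕ => (e.1 : ℤ_[p]) + e.2 * ω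
      have hs : s.card = S ^ 2 := by
        rw [Finset.card_image_of_injective, Finset.card_product, Finset.card_range, sq]
        rintro ⟨x₁, y₁⟩ ⟨x₂, y₂⟩ h
        have := hirr ((x₁ : ℤ) - x₂) ((y₁ : ℤ) - y₂) (by
          push_cast
          linear_combination h)
        rw [Prod.mk.injEq]
        omega
      have hsmall := HasGeomExpansion.norm_le_of_zeros hρ0.le hρ1 s hF (fun z hz => by
        obtain ⟨e, he, rfl⟩ := Finset.mem_image.1 hz
        rw [Finset.mem_product, Finset.mem_range, Finset.mem_range] at he
        rw [hFξ, ih _ _ he.1 he.2]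
        simp) (x + y * ω)
      rw [hFξ, hs] at hsmall
      have hbig := one_le_norm_mul_house_pow p σ hxy
      have hXmono : X S₀ ≤ X (S + 1) := by
        have : S₀ ≤ S + 1 := by omega
        have h2 : 1 ≤ H ^ (2 * S₀) := one_le_pow₀ hH1
        simp only [X]
        gcongr
      have hX0 : 0 ≤ X (S + 1) := by positivity
      have hhouse : house (ξ x y : L) ≤ (8 * n ^ 4 * c * X (S + 1)) ^ 2 := by
        have hu : ∀ u, house ((v x y u * C u : 𝓞 L) : L) ≤
            X (S + 1) * (c * (c * (8 * n ^ 4) * X (S + 1))) := fun u => by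
          rw [show ((v x y u * C u : 𝓞 L) : L) = (v x y u : L) * (C u : L) from rfl]
          refine (house_mul_le _ _).trans (mul_le_mul (hv (S + 1) x y u (by omega) hx.le hy.le)
            ((hC u).trans ?_) (house_nonneg _) hX0)
          push_cast
          gcongr
        have he : ((ξ x y : 𝓞 L) : L) = ∑ u, ((v x y u * C u : 𝓞 L) : L) := by
          simp only [ξ, map_sum]
        rw [he]
        refine (house_sum_le_sum_house _ _).trans ((Finset.sum_le_sum fun u _ => hu u).trans_eq ?_)
        rw [Finset.sum_const, Finset.card_univ, hcardU, nsmul_eq_mul]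
        push_cast
        ring
      have hn' := hn S hS
      refine absurd hbig (not_le.2 ?_)
      calc _ ≤ (1 / ρ ^ D * ρ ^ S ^ 2) * ((8 * n ^ 4 * c * X (S + 1)) ^ 2) ^ d := by
            have := house_nonneg (ξ x y : L)
            gcongr
        _ = ((p : ℝ) ^ D * (8 * n ^ 4 * c * X (S + 1)) ^ (2 * d)) / (p : ℝ) ^ S ^ 2 := by
            rw [hρ, inv_pow, inv_pow, one_div, inv_inv, ← pow_mul]
            ring
        _ < 1 := by
            rw [div_lt_one (by positivity)]
            exact hn'
  -- On the natural numbers, `F` is an exponential polynomial, so its vanishing there gives `C = 0`.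
  refine hC0 ?_
  have hc0 := eq_zero_of_sum_pow_mul_pow_eq_zero (a := κ 1)
    (fun h => by simpa [h] using κ.map_add_eq_mul 1 (-1)) hne
    (fun u => σ (C u)) fun m => by
      have h := hFξ m 0
      rw [hzero (max S₀ (m + 1)) (le_max_left _ _) m 0 (lt_max_of_lt_right (Nat.lt_succ_self m))
        (lt_max_of_lt_right (Nat.succ_pos m))] at h
      simp only [Nat.cast_zero, zero_mul, add_zero, map_zero, F, hκk] at h
      rw [← h]
      refine Finset.sum_congr rfl fun u _ => ?_
      rw [map_natCast, ← hκk m, mul_one]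
  ext u
  have := congrFun hc0 u
  simpa using this

end GelfondSchneider

/-! ### Evaluating profinite powers in finite quotients of `ℤ[t, t⁻¹]` -/

section FiniteQuotients

open LaurentPolynomial

theorem map_aeval_int {A B : Type*} [CommRing A] [CommRing B] [Algebra ℤ A] [Algebra ℤ B]
    (φ : A →+* B) (a : A) (f : Polynomial ℤ) :
    φ (Polynomial.aeval a f) = Polynomial.aeval (φ a) f := by
  rw [Polynomial.aeval_def, Polynomial.aeval_def, Polynomial.hom_eval₂]
  congr 1
  exact RingHom.ext_int _ _

/-- If a monic reciprocal polynomial vanishes at the image of `t`, then all images of Laurent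
polynomials are integral: the image of `t⁻¹` is a root as well. -/
theorem isIntegral_map_of_aeval_eq_zero {A : Type*} [CommRing A] (φ : LaurentPolynomial ℤ →+* A)
    {f : Polynomial ℤ} (hf : f.Monic) (hrec : IsReciprocalPoly f)
    (hφ : φ (Polynomial.aeval (T 1) f) = 0) :
    IsIntegral ℤ (φ (T 1)) ∧ IsIntegral ℤ (φ (T (-1))) ∧ ∀ x, IsIntegral ℤ (φ x) := by
  have h1 : Polynomial.eval₂ (algebraMap ℤ A) (φ (T 1)) f = 0 := by
    rw [← hφ, map_aeval_int, Polynomial.aeval_def]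
  have hT : φ (T 1) * φ (T (-1)) = 1 := by rw [← map_mul, ← T_add]; simp
  have hi1 : IsIntegral ℤ (φ (T 1)) := ⟨f, hf, h1⟩
  have hi2 : IsIntegral ℤ (φ (T (-1))) := by
    refine ⟨f, hf, ?_⟩
    let : Invertible (φ (T 1)) := ⟨φ (T (-1)), by rw [mul_comm, hT], hT⟩
    have h := (Polynomial.eval₂_reverse_eq_zero_iff (algebraMap ℤ A) (φ (T 1)) f).2 h1
    rwa [show f.reverse = f from hrec] at h
  refine ⟨hi1, hi2, fun x => ?_⟩
  induction x using LaurentPolynomial.induction_on' with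
  | add p q hp hq => rw [map_add]; exact hp.add hq
  | C_mul_T n a =>
    rw [map_mul]
    refine IsIntegral.mul ?_ ?_
    · rw [show (C a : LaurentPolynomial ℤ) = (a : LaurentPolynomial ℤ) from
        (eq_intCast (C : ℤ →+* LaurentPolynomial ℤ) a), map_intCast]
      exact isIntegral_algebraMap (x := a)
    · rcases Int.eq_nat_or_neg n with ⟨m, rfl | rfl⟩
      · rw [show (T (m : ℤ) : LaurentPolynomial ℤ) = T 1 ^ m by rw [T_pow, mul_one], map_pow]
        exact hi1.pow m
      · rw [show (T (-(m : ℤ)) : LaurentPolynomial ℤ) = T (-1) ^ m by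
          rw [T_pow, mul_neg, mul_one], map_pow]
        exact hi2.pow m

theorem finite_quotient_of_aeval_mem (I : Ideal (LaurentPolynomial ℤ)) {f : Polynomial ℤ}
    (hf : f.Monic) (hrec : IsReciprocalPoly f) (hfI : Polynomial.aeval (T 1) f ∈ I) {m : ℕ}
    (hm : m ≠ 0) (hmI : (m : LaurentPolynomial ℤ) ∈ I) : Finite (LaurentPolynomial ℤ ⧸ I) := by
  set φ := Ideal.Quotient.mk I
  obtain ⟨hi1, hi2, -⟩ := isIntegral_map_of_aeval_eq_zero φ hf hrec
    (Ideal.Quotient.eq_zero_iff_mem.2 hfI)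
  have htop : Algebra.adjoin ℤ {φ (T 1), φ (T (-1))} = ⊤ := by
    rw [eq_top_iff]
    rintro x -
    obtain ⟨x, rfl⟩ := Ideal.Quotient.mk_surjective x
    have h1 : φ (T 1) ∈ Algebra.adjoin ℤ {φ (T 1), φ (T (-1))} :=
      Algebra.subset_adjoin (by simp)
    have h2 : φ (T (-1)) ∈ Algebra.adjoin ℤ {φ (T 1), φ (T (-1))} :=
      Algebra.subset_adjoin (by simp)
    induction x using LaurentPolynomial.induction_on' with
    | add p q hp hq => rw [map_add]; exact add_mem hp hq
    | C_mul_T n a =>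
      rw [map_mul]
      refine mul_mem ?_ ?_
      · rw [show (C a : LaurentPolynomial ℤ) = (a : LaurentPolynomial ℤ) from
          (eq_intCast (C : ℤ →+* LaurentPolynomial ℤ) a), map_intCast]
        exact intCast_mem _ a
      · rcases Int.eq_nat_or_neg n with ⟨m, rfl | rfl⟩
        · rw [show (T (m : ℤ) : LaurentPolynomial ℤ) = T 1 ^ m by rw [T_pow, mul_one], map_pow]
          exact pow_mem h1 m
        · rw [show (T (-(m : ℤ)) : LaurentPolynomial ℤ) = T (-1) ^ m by
            rw [T_pow, mul_neg, mul_one], map_pow]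
          exact pow_mem h2 m
  have hfg := fg_adjoin_of_finite (R := ℤ) (s := {φ (T 1), φ (T (-1))}) (Set.toFinite _)
    (by rintro x (rfl | rfl); exacts [hi1, hi2])
  rw [htop, Algebra.top_toSubmodule] at hfg
  have : Module.Finite ℤ (LaurentPolynomial ℤ ⧸ I) := ⟨hfg⟩
  refine Module.finite_of_fg_torsion _ fun {x} => ?_
  refine ⟨⟨m, mem_nonZeroDivisors_of_ne_zero (by exact_mod_cast hm)⟩, ?_⟩
  obtain ⟨x, rfl⟩ := Ideal.Quotient.mk_surjective x
  change (m : ℤ) • φ x = 0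
  rw [zsmul_eq_mul, Int.cast_natCast, ← map_natCast φ, Ideal.Quotient.eq_zero_iff_mem.2 hmI,
    zero_mul]

/-- Divisibility of `f(t ^ ν)` by `f(t)` in the profinite completion, read off in a finite quotient
in which `f(t)` vanishes. -/
theorem exists_aeval_pow_mem {f : Polynomial ℤ} {ν : ZHat}
    (hdvd : Polynomial.aeval ProfiniteRing.tHat f ∣
      Polynomial.aeval (ProfiniteRing.tHatPow ν) f)
    (I : Ideal (LaurentPolynomial ℤ)) [hI : Finite (LaurentPolynomial ℤ ⧸ I)]
    (hfI : Polynomial.aeval (T 1) f ∈ I) :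
    ∃ N : ℕ+, (T 1 : LaurentPolynomial ℤ) ^ (N : ℕ) - 1 ∈ I ∧
      ∀ m : ℕ, (m : ZMod N) = ν.1 N → Polynomial.aeval ((T 1 : LaurentPolynomial ℤ) ^ m) f ∈ I := by
  set u := Units.map (Ideal.Quotient.mk I : LaurentPolynomial ℤ →* LaurentPolynomial ℤ ⧸ I)
    ProfiniteRing.tUnit with hu
  have hu1 : (u : LaurentPolynomial ℤ ⧸ I) = Ideal.Quotient.mk I (T 1) := rfl
  refine ⟨⟨orderOf u, orderOf_pos u⟩, ?_, fun m hm => ?_⟩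
  · rw [← Ideal.Quotient.eq_zero_iff_mem, map_sub, map_pow, map_one, ← hu1, PNat.mk_coe,
      ← Units.val_pow_eq_pow_val, pow_orderOf_eq_one, Units.val_one, sub_self]
  · let π : ProfiniteRing.Completion (LaurentPolynomial ℤ) →+* LaurentPolynomial ℤ ⧸ I :=
      (Pi.evalRingHom _ (⟨I, hI⟩ : ProfiniteRing.FiniteIndexIdeal (LaurentPolynomial ℤ))).comp
        (ProfiniteRing.completionSubring (LaurentPolynomial ℤ)).subtype
    have h1 : π ProfiniteRing.tHat = Ideal.Quotient.mk I (T 1) := rfl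
    have h2 : π (ProfiniteRing.tHatPow ν) = Ideal.Quotient.mk I (T 1 ^ m) := by
      change ((zhatPow u ν : (LaurentPolynomial ℤ ⧸ I)ˣ) : LaurentPolynomial ℤ ⧸ I) = _
      rw [map_pow, ← hu1, ← Units.val_pow_eq_pow_val, zhatPow]
      congr 1
      rw [pow_eq_pow_iff_modEq, ← ZMod.natCast_eq_natCast_iff]
      exact (zhat_val_cast ν ⟨orderOf u, orderOf_pos u⟩ _ dvd_rfl).trans hm.symm
    have h3 := map_dvd π hdvd
    rw [map_aeval_int, map_aeval_int, h1, h2, ← map_aeval_int, ← map_aeval_int,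
      Ideal.Quotient.eq_zero_iff_mem.2 hfI, zero_dvd_iff] at h3
    exact Ideal.Quotient.eq_zero_iff_mem.1 h3

/-- The analytic consequence of the divisibility of `f(t ^ ν)` by `f(t)`: at a root `α` of `f`, the
powers `α ^ m` with `m` close to `ν` are approximate roots of `f`. The finite quotient used is that
by the ideal of Laurent polynomials that are small at `α`. -/
theorem exists_norm_aeval_pow_le (p : ℕ) [Fact p.Prime] {K : Type*} [NormedField K]
    [Algebra ℤ_[p] K] [NormSMulClass ℤ_[p] K] [IsUltrametricDist K] {f : Polynomial ℤ}
    (hf : f.Monic) (hrec : IsReciprocalPoly f) {ν : ZHat}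
    (hdvd : Polynomial.aeval ProfiniteRing.tHat f ∣
      Polynomial.aeval (ProfiniteRing.tHatPow ν) f)
    {α : K} (hα0 : α ≠ 0) (hα : Polynomial.aeval α f = 0) {ε : ℝ} (hε : 0 < ε) :
    ∃ N : ℕ+, ‖α ^ (N : ℕ) - 1‖ ≤ ε ∧
      ∀ m : ℕ, (m : ZMod N) = ν.1 N → ‖Polynomial.aeval (α ^ m) f‖ ≤ ε := by
  let φ : LaurentPolynomial ℤ →+* K := LaurentPolynomial.eval₂ (Int.castRingHom K) (Units.mk0 α hα0)
  have hφT : φ (T 1) = α := by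
    have := LaurentPolynomial.eval₂_T_n (Int.castRingHom K) (Units.mk0 α hα0) 1
    rwa [Nat.cast_one, pow_one] at this
  have hφf : φ (Polynomial.aeval (T 1) f) = 0 := by rw [map_aeval_int, hφT, hα]
  have hφ1 : ∀ x, ‖φ x‖ ≤ 1 := fun x =>
    ((isIntegral_map_of_aeval_eq_zero φ hf hrec hφf).2.2 x).norm_le_one_of_isUltrametricDist
  let I : Ideal (LaurentPolynomial ℤ) :=
    { carrier := {x | ‖φ x‖ ≤ ε}
      add_mem' := fun {x y} hx hy => by
        change ‖φ (x + y)‖ ≤ ε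
        rw [map_add]
        exact (IsUltrametricDist.norm_add_le_max _ _).trans (max_le hx hy)
      zero_mem' := by
        change ‖φ 0‖ ≤ ε
        rw [map_zero, norm_zero]; exact hε.le
      smul_mem' := fun c x hx => by
        change ‖φ (c * x)‖ ≤ ε
        rw [map_mul, norm_mul]
        exact (mul_le_of_le_one_left (norm_nonneg _) (hφ1 c)).trans hx }
  have hmem : ∀ x, x ∈ I ↔ ‖φ x‖ ≤ ε := fun _ => Iff.rfl
  have hfI : Polynomial.aeval (T 1) f ∈ I := by rw [hmem, hφf, norm_zero]; exact hε.le
  have hp : p.Prime := Fact.out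
  obtain ⟨j, hj⟩ := exists_pow_lt_of_lt_one hε
    (inv_lt_one_of_one_lt₀ (show (1 : ℝ) < p by exact_mod_cast hp.one_lt))
  have : Finite (LaurentPolynomial ℤ ⧸ I) := by
    refine finite_quotient_of_aeval_mem I hf hrec hfI (m := p ^ j) (pow_ne_zero _ hp.ne_zero) ?_
    rw [hmem, map_natCast, ← map_natCast (algebraMap ℤ_[p] K), norm_algebraMap_padicInt,
      Nat.cast_pow, norm_pow, PadicInt.norm_p]
    exact hj.le
  obtain ⟨N, hN1, hN⟩ := exists_aeval_pow_mem hdvd I hfI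
  refine ⟨N, ?_, fun m hm => ?_⟩
  · rwa [hmem, map_sub, map_pow, map_one, hφT] at hN1
  · have := hN m hm
    rwa [hmem, map_aeval_int, map_pow, hφT] at this

end FiniteQuotients

/-! ### The action of a profinite integer on the roots -/

section ZHatToPadic

variable (p : ℕ) [Fact p.Prime]

/-- The projection of the profinite integers to `ℤ_[p]`. -/
noncomputable def zhatToPadic : ZHat →+* ℤ_[p] :=
  PadicInt.lift (p := p)
    (f := fun k => (Pi.evalRingHom (fun n : ℕ+ => ZMod n)
      (⟨p ^ k, pow_pos (Fact.out : p.Prime).pos k⟩ : ℕ+)).comp zhatSubring.subtype)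
    (fun k₁ k₂ hk => RingHom.ext fun x =>
      x.2 ⟨p ^ k₁, pow_pos (Fact.out : p.Prime).pos k₁⟩
        ⟨p ^ k₂, pow_pos (Fact.out : p.Prime).pos k₂⟩ (pow_dvd_pow p hk))

theorem toZModPow_zhatToPadic (ν : ZHat) (k : ℕ) :
    PadicInt.toZModPow k (zhatToPadic p ν) =
      ν.1 ⟨p ^ k, pow_pos (Fact.out : p.Prime).pos k⟩ :=
  RingHom.congr_fun (PadicInt.lift_spec _ k) ν

theorem norm_natCast_sub_zhatToPadic_le {ν : ZHat} {k m : ℕ}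
    (h : (m : ZMod (p ^ k)) = ν.1 ⟨p ^ k, pow_pos (Fact.out : p.Prime).pos k⟩) :
    ‖(m : ℤ_[p]) - zhatToPadic p ν‖ ≤ ((p : ℝ)⁻¹) ^ k := by
  rw [inv_pow, ← zpow_natCast, ← zpow_neg, PadicInt.norm_le_pow_iff_mem_span_pow,
    ← PadicInt.ker_toZModPow, RingHom.mem_ker, map_sub, map_natCast, sub_eq_zero]
  exact h.trans (toZModPow_zhatToPadic p ν k).symm

/-- A profinite integer is determined by its images in the rings `ℤ_[p]`. -/
theorem eq_one_of_zhatToPadic_eq_one {ν : ZHat}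
    (h : ∀ (p : ℕ) [Fact p.Prime], zhatToPadic p ν = 1) : ν = 1 := by
  refine Subtype.ext (funext fun n => ?_)
  set m := (ν.1 n).val with hm
  have hmn : ν.1 n = (m : ZMod n) := (ZMod.natCast_zmod_val _).symm
  have hdvd : (n : ℕ) ∣ ((m : ℤ) - 1).natAbs := by
    rw [Nat.dvd_iff_prime_pow_dvd_dvd]
    intro p k hp hpk
    have : Fact p.Prime := ⟨hp⟩
    have h1 := toZModPow_zhatToPadic p ν k
    rw [h p, map_one, ← zhat_val_cast ν ⟨p ^ k, pow_pos (Fact.out : p.Prime).pos k⟩ n hpk] at h1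
    rw [← Int.natCast_dvd, ← ZMod.intCast_zmod_eq_zero_iff_dvd]
    push_cast
    rw [sub_eq_zero]
    exact h1.symm
  rw [← Int.natCast_dvd, ← ZMod.intCast_zmod_eq_zero_iff_dvd] at hdvd
  push_cast at hdvd
  rw [hmn, sub_eq_zero.1 hdvd]
  rfl

end ZHatToPadic

section Roots

open Filter Topology

variable {p : ℕ} [Fact p.Prime] {K : Type*} [NormedField K] [Algebra ℤ_[p] K]
  [NormSMulClass ℤ_[p] K] [IsUltrametricDist K]

theorem norm_pow_sub_pow_le {x y : K} (hx : ‖x‖ ≤ 1) (hy : ‖y‖ ≤ 1) (n : ℕ) :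
    ‖x ^ n - y ^ n‖ ≤ ‖x - y‖ := by
  rw [← (Commute.all x y).mul_geom_sum₂, norm_mul]
  refine mul_le_of_le_one_right (norm_nonneg _) ?_
  refine IsUltrametricDist.norm_sum_le_of_forall_le_of_nonneg zero_le_one fun i _ => ?_
  rw [norm_mul, norm_pow, norm_pow]
  exact mul_le_one₀ (pow_le_one₀ (norm_nonneg _) hx) (by positivity)
    (pow_le_one₀ (norm_nonneg _) hy)

variable {f : Polynomial ℤ} {ν : ZHat}

/-- The value at `ν` of the character `z ↦ (α ^ M) ^ z` is `β ^ M` for a root `β` of `f`: it is a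
limit of values `(α ^ M) ^ m` at natural numbers `m`, along which `f (α ^ m)`, and so the product
of the `α ^ m - β` over all roots `β`, tends to zero. -/
theorem exists_root_addChar_eq_pow [IsAlgClosed K] (hf : f.Monic) (hrec : IsReciprocalPoly f)
    (hdvd : Polynomial.aeval ProfiniteRing.tHat f ∣
      Polynomial.aeval (ProfiniteRing.tHatPow ν) f)
    {α : K} (hα0 : α ≠ 0) (hα : Polynomial.aeval α f = 0) {κ : AddChar ℤ_[p] K}
    (hκ : Continuous κ) {M : ℕ} (hM : κ 1 = α ^ M) :
    ∃ β : K, Polynomial.aeval β f = 0 ∧ κ (zhatToPadic p ν) = β ^ M := by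
  have hp : p.Prime := Fact.out
  have hp1 : (p : ℝ)⁻¹ < 1 := inv_lt_one_of_one_lt₀ (by exact_mod_cast hp.one_lt)
  have hp0 : (0 : ℝ) < (p : ℝ)⁻¹ := by have := hp.pos; positivity
  set g := f.map (algebraMap ℤ K) with hg
  have hgm : g.Monic := hf.map _
  have heval : ∀ x, Polynomial.aeval x f = (g.roots.map (x - ·)).prod := fun x => by
    rw [← (IsAlgClosed.splits g).eval_eq_prod_roots_of_monic hgm, hg, Polynomial.eval_map_algebraMap]
  have hroot : ∀ β ∈ g.roots, Polynomial.aeval β f = 0 := fun β hβ => by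
    have := (Polynomial.mem_roots'.1 hβ).2
    rwa [hg, Polynomial.IsRoot.def, Polynomial.eval_map_algebraMap] at this
  have hnorm : ∀ β : K, Polynomial.aeval β f = 0 → ‖β‖ ≤ 1 := fun β hβ =>
    IsIntegral.norm_le_one_of_isUltrametricDist ⟨f, hf, hβ⟩
  have hm : ∀ j : ℕ, ∃ m : ℕ, ‖(m : ℤ_[p]) - zhatToPadic p ν‖ ≤ ((p : ℝ)⁻¹) ^ j ∧
      ‖Polynomial.aeval (α ^ m) f‖ ≤ ((p : ℝ)⁻¹) ^ j := fun j => by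
    obtain ⟨N, -, hN⟩ := exists_norm_aeval_pow_le p hf hrec hdvd hα0 hα (pow_pos hp0 j)
    -- An exponent congruent to `ν` both modulo `p ^ j` and modulo `N`.
    let P : ℕ+ := ⟨p ^ j, pow_pos hp.pos j⟩
    refine ⟨(ν.1 (P * N)).val, norm_natCast_sub_zhatToPadic_le p ?_, hN _ ?_⟩
    · exact zhat_val_cast ν P (P * N) (by rw [PNat.mul_coe]; exact dvd_mul_right _ _)
    · exact zhat_val_cast ν N (P * N) (by rw [PNat.mul_coe]; exact dvd_mul_left _ _)
  choose m hm1 hm2 using hm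
  have hpow : Tendsto (fun j : ℕ => ((p : ℝ)⁻¹) ^ j) atTop (𝓝 0) :=
    tendsto_pow_atTop_nhds_zero_of_lt_one hp0.le hp1
  have hmlim : Tendsto (fun j => (m j : ℤ_[p])) atTop (𝓝 (zhatToPadic p ν)) := by
    rw [tendsto_iff_norm_sub_tendsto_zero]
    exact squeeze_zero (fun _ => norm_nonneg _) hm1 hpow
  have hκlim : Tendsto (fun j => κ (m j : ℤ_[p])) atTop (𝓝 (κ (zhatToPadic p ν))) :=
    (hκ.tendsto _).comp hmlim
  have hκm : ∀ m : ℕ, κ (m : ℤ_[p]) = (α ^ m) ^ M := fun m => by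
    rw [← nsmul_one, AddChar.map_nsmul_eq_pow, hM, ← pow_mul, ← pow_mul, mul_comm]
  have hprod : Tendsto (fun j => (g.roots.map fun β => κ (m j : ℤ_[p]) - β ^ M).prod) atTop
      (𝓝 (g.roots.map fun β => κ (zhatToPadic p ν) - β ^ M).prod) :=
    tendsto_multiset_prod _ fun β _ => hκlim.sub_const _
  have hprod0 : Tendsto (fun j => (g.roots.map fun β => κ (m j : ℤ_[p]) - β ^ M).prod) atTop
      (𝓝 0) := by
    refine squeeze_zero_norm (fun j => ?_) hpow
    refine le_trans ?_ (hm2 j)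
    rw [heval]
    have hnp : ∀ s : Multiset K, ‖s.prod‖ = (s.map norm).prod := fun s =>
      map_multiset_prod (normHom : K →*₀ ℝ) s
    rw [hnp, hnp, Multiset.map_map, Multiset.map_map]
    refine Multiset.prod_map_le_prod_map₀ _ _ (fun _ _ => norm_nonneg _) fun β hβ => ?_
    simp only [Function.comp_apply, hκm]
    refine norm_pow_sub_pow_le ?_ (hnorm β (hroot β hβ)) M
    rw [norm_pow]
    exact pow_le_one₀ (norm_nonneg _) (hnorm α hα)
  have h0 := tendsto_nhds_unique hprod hprod0
  rw [Multiset.prod_eq_zero_iff, Multiset.mem_map] at h0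
  obtain ⟨β, hβ, h⟩ := h0
  exact ⟨β, hroot β hβ, sub_eq_zero.1 h⟩

variable [CompleteSpace K]

/-- If `κ y = 1` with `y ≠ 0`, the analytic function `κ - 1` has the infinitely many zeros `n * y`. -/
theorem AddChar.eq_one_of_apply_eq_one {κ : AddChar ℤ_[p] K} (hκ : Continuous κ)
    (h1 : ‖κ 1 - 1‖ ≤ ((p : ℝ)⁻¹) ^ 2) {y : ℤ_[p]} (hy : y ≠ 0) (h : κ y = 1) : κ 1 = 1 := by
  have hp : p.Prime := Fact.out
  have hp1 : (p : ℝ)⁻¹ < 1 := inv_lt_one_of_one_lt₀ (by exact_mod_cast hp.one_lt)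
  have hp0 : (0 : ℝ) < (p : ℝ)⁻¹ := by have := hp.pos; positivity
  have hF : HasGeomExpansion (p : ℝ)⁻¹ 1 fun z => κ z + -1 :=
    (AddChar.hasGeomExpansion hκ h1).add (.const (by simp) hp0.le)
  refine add_neg_eq_zero.1 (hF.eq_zero_of_infinite_zeros hp0.le hp1 ?_ 1)
  have hinj : Function.Injective fun n : ℕ => (n : ℤ_[p]) * y := fun a b hab =>
    Nat.cast_injective (mul_right_cancel₀ hy hab)
  refine (Set.infinite_range_of_injective hinj).mono ?_
  rintro _ ⟨n, rfl⟩
  change κ ((n : ℤ_[p]) * y) + -1 = 0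
  rw [← nsmul_eq_mul, AddChar.map_nsmul_eq_pow, h, one_pow, add_neg_cancel]

/-- Raising to the power `ν` maps the finitely many roots of `f` to roots; so if the root `α` is not a
root of unity, two powers of the `p`-adic component of `ν` with distinct exponents agree. The exponent `M` makes all
the functions `z ↦ (α ^ M) ^ z` analytic. -/
theorem exists_addChar_and_pow_eq_pow [IsAlgClosed K] (hf : f.Monic) (hrec : IsReciprocalPoly f)
    (hdvd : Polynomial.aeval ProfiniteRing.tHat f ∣
      Polynomial.aeval (ProfiniteRing.tHatPow ν) f)
    {α : K} (hα : Polynomial.aeval α f = 0) (hα1 : ∀ n : ℕ, 0 < n → α ^ n ≠ 1) :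
    ∃ (κ : AddChar ℤ_[p] K) (M : ℕ) (β : K), Continuous κ ∧ 0 < M ∧ κ 1 = α ^ M ∧
      ‖κ 1 - 1‖ ≤ ((p : ℝ)⁻¹) ^ 2 ∧ Polynomial.aeval β f = 0 ∧ κ (zhatToPadic p ν) = β ^ M ∧
      ∃ i j : ℕ, i < j ∧ zhatToPadic p ν ^ i = zhatToPadic p ν ^ j := by
  have hp : p.Prime := Fact.out
  have hp1 : (p : ℝ)⁻¹ < 1 := inv_lt_one_of_one_lt₀ (by exact_mod_cast hp.one_lt)
  have hp0 : (0 : ℝ) < (p : ℝ)⁻¹ := by have := hp.pos; positivity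
  let R := {x : K // Polynomial.aeval x f = 0}
  have := charZero_of_normSMulClass_padicInt p K
  have hR : Finite R := by
    refine (Multiset.finite_toSet (f.map (algebraMap ℤ K)).roots).subset (fun x hx => ?_) |>.to_subtype
    refine (Polynomial.mem_roots (hf.map _).ne_zero).2 ?_
    rw [Polynomial.IsRoot.def, Polynomial.eval_map_algebraMap]
    exact hx
  have hf0 : f.coeff 0 = 1 := by
    rw [← show f.reverse = f from hrec, Polynomial.coeff_zero_reverse, hf.leadingCoeff]
  have hR0 : ∀ x : R, x.1 ≠ 0 := fun x hx => by
    have := x.2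
    rw [hx, Polynomial.aeval_def, Polynomial.eval₂_at_zero, hf0] at this
    simp at this
  have hN : ∀ x : R, ∃ N : ℕ+, ‖x.1 ^ (N : ℕ) - 1‖ ≤ ((p : ℝ)⁻¹) ^ 2 := fun x => by
    obtain ⟨N, hN, -⟩ := exists_norm_aeval_pow_le p hf hrec hdvd (hR0 x) x.2 (pow_pos hp0 2)
    exact ⟨N, hN⟩
  choose N hN using hN
  have := Fintype.ofFinite R
  set M : ℕ := ∏ x, (N x : ℕ) with hMdef
  have hM0 : 0 < M := Finset.prod_pos fun x _ => (N x).pos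
  have hnorm : ∀ x : R, ‖x.1‖ ≤ 1 := fun x =>
    IsIntegral.norm_le_one_of_isUltrametricDist ⟨f, hf, x.2⟩
  have hM : ∀ x : R, ‖x.1 ^ M - 1‖ ≤ ((p : ℝ)⁻¹) ^ 2 := fun x => by
    obtain ⟨c, hc⟩ := Finset.dvd_prod_of_mem (fun x => (N x : ℕ)) (Finset.mem_univ x)
    rw [hMdef, hc, pow_mul]
    have h := norm_pow_sub_pow_le (x := x.1 ^ (N x : ℕ)) (y := 1)
      (by rw [norm_pow]; exact pow_le_one₀ (norm_nonneg _) (hnorm x)) (by rw [norm_one]) c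
    rw [one_pow] at h
    exact h.trans (hN x)
  have hex : ∀ x : R, ∃ κ : AddChar ℤ_[p] K, Continuous κ ∧ κ 1 = x.1 ^ M := fun x => by
    have hr : Tendsto ((x.1 ^ M - 1) ^ ·) atTop (𝓝 0) :=
      tendsto_pow_atTop_nhds_zero_iff_norm_lt_one.2
        ((hM x).trans_lt (pow_lt_one₀ hp0.le hp1 two_ne_zero))
    exact ⟨PadicInt.addChar_of_value_at_one _ hr, by fun_prop, by simp⟩
  choose κ hκ hκ1 using hex
  have hτ : ∀ x : R, ∃ y : R, κ x (zhatToPadic p ν) = y.1 ^ M := fun x => by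
    obtain ⟨β, hβ, h⟩ := exists_root_addChar_eq_pow hf hrec hdvd (hR0 x) x.2 (hκ x) (hκ1 x)
    exact ⟨⟨β, hβ⟩, h⟩
  choose τ hτ using hτ
  set ω := zhatToPadic p ν with hω
  have hcomp : ∀ x z, κ x (ω * z) = κ (τ x) z := fun x z => by
    have h := PadicInt.denseRange_natCast.addChar_eq_of_eval_one_eq
      (κ₁ := (κ x).compAddMonoidHom (AddMonoidHom.mulLeft ω)) (κ₂ := κ (τ x))
      ((hκ x).comp (continuous_const.mul continuous_id)) (hκ (τ x))
      (by simp [hτ x, hκ1])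
    exact DFunLike.congr_fun h z
  have hiter : ∀ (i : ℕ) (x : R), κ x (ω ^ i) = (τ^[i] x).1 ^ M := fun i => by
    induction i with
    | zero => intro x; simp [hκ1]
    | succ i ih => intro x; rw [pow_succ', hcomp, ih, Function.iterate_succ_apply]
  let a : R := ⟨α, hα⟩
  refine ⟨κ a, M, (τ a).1, hκ a, hM0, hκ1 a, by rw [hκ1]; exact hM a, (τ a).2, hτ a, ?_⟩
  obtain ⟨i, j, hij, h⟩ := Finite.exists_ne_map_eq_of_infinite fun i : ℕ => τ^[i] a
  wlog hlt : i < j generalizing i j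
  · exact this j i hij.symm h.symm (by omega)
  refine ⟨i, j, hlt, ?_⟩
  by_contra hne
  have hone : κ a (ω ^ i - ω ^ j) = 1 := by
    have h0 : κ a (ω ^ j) ≠ 0 := by
      rw [hiter]; exact pow_ne_zero _ (hR0 _)
    have h1 : κ a (ω ^ i - ω ^ j) * κ a (ω ^ j) = 1 * κ a (ω ^ j) := by
      rw [← AddChar.map_add_eq_mul, sub_add_cancel, hiter, hiter, one_mul]
      exact congrArg (fun x : R => x.1 ^ M) h
    exact mul_right_cancel₀ h0 h1
  have := AddChar.eq_one_of_apply_eq_one (hκ a) (by rw [hκ1]; exact hM a) (sub_ne_zero.2 hne) hone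
  rw [hκ1] at this
  exact hα1 M hM0 this

/-- If some root of `f` is not a root of unity, the `p`-adic component of a unit `ν` such that
`f(t)` divides `f(t ^ ν)` is `1` or `-1`: it is a root of unity, and it is rational by the theorem of
Gelfond and Schneider. -/
theorem zhatToPadic_sq_eq_one [IsAlgClosed K] (hf : f.Monic) (hrec : IsReciprocalPoly f)
    (μ : ZHatˣ)
    (hdvd : Polynomial.aeval ProfiniteRing.tHat f ∣
      Polynomial.aeval (ProfiniteRing.tHatPow (μ : ZHat)) f)
    {α : K} (hα : Polynomial.aeval α f = 0) (hα1 : ∀ n : ℕ, 0 < n → α ^ n ≠ 1) :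
    zhatToPadic p (μ : ZHat) ^ 2 = 1 := by
  obtain ⟨κ, M, β, hκ, hM0, hκ1, hκM, hβ, hκω, i, j, hij, hpow⟩ :=
    exists_addChar_and_pow_eq_pow (p := p) hf hrec hdvd hα hα1
  set ω := zhatToPadic p (μ : ZHat) with hω
  have hu : IsUnit ω := μ.isUnit.map (zhatToPadic p)
  obtain ⟨k, hk⟩ := Nat.exists_eq_add_of_lt hij
  have hωk : ω ^ (k + 1) = 1 := by
    have h : ω ^ i * ω ^ (k + 1) = ω ^ i * 1 := by
      rw [← pow_add, mul_one, ← add_assoc, ← hk, hpow]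
    exact (hu.pow i).mul_left_cancel h
  by_contra hsq
  have hirr : ∀ x y : ℤ, (x : ℤ_[p]) + y * ω = 0 → x = 0 ∧ y = 0 := by
    intro x y hxy
    have hxy' : (x : ℤ_[p]) = -y * ω := by linear_combination hxy
    have h2 : (x : ℤ_[p]) ^ (k + 1) = (-y) ^ (k + 1) := by rw [hxy', mul_pow, hωk, mul_one]
    have h3 : x ^ (k + 1) = (-y) ^ (k + 1) := by exact_mod_cast h2
    have h4 : x.natAbs = y.natAbs := by
      have := congrArg Int.natAbs h3
      rw [Int.natAbs_pow, Int.natAbs_pow, Int.natAbs_neg] at this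
      exact Nat.pow_left_injective k.succ_ne_zero this
    have hy : y = 0 := by
      by_contra hy
      have hx2 : (x : ℤ_[p]) ^ 2 = y ^ 2 := by exact_mod_cast Int.natAbs_eq_iff_sq_eq.1 h4
      have hy2 : (y : ℤ_[p]) ^ 2 ≠ 0 := pow_ne_zero _ (by exact_mod_cast hy)
      rw [hxy', mul_pow, neg_sq] at hx2
      exact hsq (mul_left_cancel₀ hy2 (hx2.trans (mul_one _).symm))
    exact ⟨Int.natAbs_eq_zero.1 (by rw [h4, hy]; rfl), hy⟩
  have := charZero_of_normSMulClass_padicInt p K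
  set w := algebraMap ℤ_[p] K ω with hw
  have hαi : IsIntegral ℤ (κ 1) := by
    rw [hκ1]; exact IsIntegral.pow ⟨f, hf, hα⟩ M
  have hβi : IsIntegral ℤ (κ ω) := by
    rw [hκω]; exact IsIntegral.pow ⟨f, hf, hβ⟩ M
  have hwi : IsIntegral ℤ w := by
    refine IsIntegral.of_pow k.succ_pos ?_
    rw [hw, ← map_pow, hωk, map_one]
    exact isIntegral_one
  let L := IntermediateField.adjoin ℚ {κ 1, κ ω, w}
  have : FiniteDimensional ℚ L := IntermediateField.finiteDimensional_adjoin (by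
    rintro x (rfl | rfl | rfl)
    exacts [hαi.tower_top, hβi.tower_top, hwi.tower_top])
  have : NumberField L := ⟨⟩
  have hlift : ∀ x ∈ ({κ 1, κ ω, w} : Set K), IsIntegral ℤ x →
      ∃ y : NumberField.RingOfIntegers L, L.val y = x := fun x hx hxi => by
    let y : L := ⟨x, IntermediateField.subset_adjoin _ _ hx⟩
    have hy : IsIntegral ℤ y := (isIntegral_algebraMap_iff (B := K) L.val.injective).1 hxi
    exact ⟨⟨y, hy⟩, rfl⟩
  obtain ⟨a, ha⟩ := hlift (κ 1) (by simp) hαi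
  obtain ⟨b, hb⟩ := hlift (κ ω) (by simp) hβi
  obtain ⟨c, hc⟩ := hlift w (by simp) hwi
  obtain ⟨n, hn, h⟩ := exists_pow_eq_one_of_addChar_algebraic (L := L) (L.val : L →+* K) hκ hκM
    ha hb hc hirr
  rw [hκ1, ← pow_mul] at h
  exact hα1 (M * n) (Nat.mul_pos hM0 hn) h

end Roots

/-! ### Products of cyclotomic polynomials -/

theorem isProductOfCyclotomics_iff {f : Polynomial ℤ} : IsProductOfCyclotomics f ↔
    ∃ s : Multiset ℕ+, f = (s.map fun n : ℕ+ => Polynomial.cyclotomic (n : ℕ) ℤ).prod := by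
  refine exists_congr fun s => ?_
  -- The definition coerces the elements of `s` to natural numbers through the multiset monad.
  change f = ((s.bind fun n : ℕ+ => {(n : ℕ)}).map fun n => Polynomial.cyclotomic n ℤ).prod ↔ _
  rw [Multiset.bind_singleton, Multiset.map_map]
  rfl

/-- By induction on the degree: the minimal polynomial of a root is a
cyclotomic polynomial and divides `f`. -/
theorem isProductOfCyclotomics_of_roots (K : Type*) [Field K] [CharZero K] [IsAlgClosed K]
    {f : Polynomial ℤ} (hf : f.Monic)
    (h : ∀ x : K, Polynomial.aeval x f = 0 → ∃ n : ℕ, 0 < n ∧ x ^ n = 1) :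
    IsProductOfCyclotomics f := by
  rw [isProductOfCyclotomics_iff]
  induction hd : f.natDegree using Nat.strong_induction_on generalizing f with
  | _ d ih =>
    rcases Nat.eq_zero_or_pos d with h0 | hpos
    · exact ⟨0, by simpa using hf.natDegree_eq_zero.1 (hd.trans h0)⟩
    obtain ⟨x, hx⟩ := IsAlgClosed.exists_aeval_eq_zero_of_injective K
      (FaithfulSMul.algebraMap_injective ℤ K) f (by
        rw [Polynomial.degree_eq_natDegree hf.ne_zero, hd]; exact_mod_cast hpos.ne')
    obtain ⟨n, hn, hxn⟩ := h x hx
    have hord : 0 < orderOf x := orderOf_pos_iff.2 (isOfFinOrder_iff_pow_eq_one.2 ⟨n, hn, hxn⟩)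
    have hprim := IsPrimitiveRoot.orderOf x
    have hint : IsIntegral ℤ x := ⟨f, hf, hx⟩
    obtain ⟨g, hg⟩ : Polynomial.cyclotomic (orderOf x) ℤ ∣ f := by
      rw [Polynomial.cyclotomic_eq_minpoly hprim hord]
      exact minpoly.isIntegrallyClosed_dvd hint hx
    have hcm := Polynomial.cyclotomic.monic (orderOf x) ℤ
    have hgm : g.Monic := hcm.of_mul_monic_left (hg ▸ hf)
    have hdeg : g.natDegree < d := by
      rw [← hd, hg, hcm.natDegree_mul hgm, Polynomial.natDegree_cyclotomic]
      have := Nat.totient_pos.2 hord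
      omega
    obtain ⟨s, hs⟩ := ih _ hdeg hgm (fun y hy => h y (by rw [hg, map_mul, hy, mul_zero])) rfl
    refine ⟨(orderOf x).toPNat hord ::ₘ s, ?_⟩
    rw [Multiset.map_cons, Multiset.prod_cons, ← hs]
    exact hg

theorem isProductOfCyclotomics_or_zhatToPadic_sq_eq_one (p : ℕ) [Fact p.Prime] (K : Type*)
    [NormedField K] [Algebra ℤ_[p] K] [NormSMulClass ℤ_[p] K] [IsUltrametricDist K]
    [CompleteSpace K] [IsAlgClosed K] {f : Polynomial ℤ} (hf : f.Monic) (hrec : IsReciprocalPoly f)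
    (μ : ZHatˣ)
    (hdvd : Polynomial.aeval ProfiniteRing.tHat f ∣
      Polynomial.aeval (ProfiniteRing.tHatPow (μ : ZHat)) f) :
    IsProductOfCyclotomics f ∨ zhatToPadic p (μ : ZHat) ^ 2 = 1 := by
  have := charZero_of_normSMulClass_padicInt p K
  refine or_iff_not_imp_left.2 fun hcyc => ?_
  obtain ⟨α, hα, hα1⟩ : ∃ α : K, Polynomial.aeval α f = 0 ∧ ∀ n : ℕ, 0 < n → α ^ n ≠ 1 := by
    by_contra! h
    exact hcyc (isProductOfCyclotomics_of_roots K hf h)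
  exact zhatToPadic_sq_eq_one hf hrec μ hdvd hα hα1

/-! ### The field `ℂ_[p]` and the conclusion -/

section PadicComplex

variable (p : ℕ) [Fact p.Prime]

/-- The algebra structure of `ℂ_[p]` over `ℤ_[p]`, through `ℚ_[p]`. It is not an instance, because
`ℂ_[p]` already carries a scalar multiplication by `ℤ_[p]` as a completion. -/
noncomputable abbrev PadicComplex.algebraPadicInt : Algebra ℤ_[p] ℂ_[p] :=
  ((algebraMap ℚ_[p] ℂ_[p]).comp PadicInt.Coe.ringHom).toAlgebra

theorem PadicComplex.normSMulClass_padicInt :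
    @NormSMulClass ℤ_[p] ℂ_[p] _ _ (PadicComplex.algebraPadicInt p).toSMul :=
  let := PadicComplex.algebraPadicInt p
  @NormSMulClass.mk _ _ _ _ (PadicComplex.algebraPadicInt p).toSMul fun r x =>
    (norm_mul (algebraMap ℚ_[p] ℂ_[p] (r : ℚ_[p])) x).trans
      (congrArg (· * ‖x‖) ((PadicComplex.norm_extends' p (r : ℚ_[p])).trans
        (PadicInt.norm_def (z := r)).symm))

end PadicComplex

theorem mainTheorem8 (f : Polynomial ℤ) (hmonic : f.Monic) (hrec : IsReciprocalPoly f)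
    (μ : ZHatˣ)
    (hμ : (Ideal.span {Polynomial.aeval ProfiniteRing.tHat f} :
        Ideal (ProfiniteRing.Completion (LaurentPolynomial ℤ))) =
      Ideal.span {Polynomial.aeval (ProfiniteRing.tHatPow (μ : ZHat)) f}) :
    IsProductOfCyclotomics f ∨ μ ^ 2 = 1 := by
  have hdvd : Polynomial.aeval ProfiniteRing.tHat f ∣
      Polynomial.aeval (ProfiniteRing.tHatPow (μ : ZHat)) f :=
    Ideal.span_singleton_le_span_singleton.1 hμ.ge
  by_cases hf : IsProductOfCyclotomics f
  · exact Or.inl hf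
  refine Or.inr (Units.ext (eq_one_of_zhatToPadic_eq_one fun p _ => ?_))
  rw [Units.val_pow_eq_pow_val, map_pow]
  let := PadicComplex.algebraPadicInt p
  have := PadicComplex.normSMulClass_padicInt p
  exact (isProductOfCyclotomics_or_zhatToPadic_sq_eq_one p ℂ_[p] hmonic hrec μ hdvd).resolve_left hf
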